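/- Let $\Gamma=SL_2(\mathbb Z)$, let $E_2,E_4,E_6$ be the Eisenstein series of weights $2,4,6$ on $\Gamma$ with constant term $1$, viewed as functions on the upper half-plane, let $QM_*(\Gamma)=\mathbb C[E_2,E_4,E_6]$ be the ring of quasimodular forms, graded by weight (its weight-$w$ part $QM_w$ is spanned by the $E_2^{\ell}E_4^{m}E_6^{n}$ with $2\ell+4m+6n=w$), let $D=\frac1{2\pi i}\frac{d}{d\tau}$, and let $j=E_4^3/\Delta$ with $\Delta=q\prod_{n\ge1}(1-q^n)^{24}$, $q=e^{2\pi i\tau}$. In $\mathbb C[\![t]\!]$ put $$\mathcal F_1(t)={}_2F_1\!\left(\tfrac1{12},\tfrac5{12};1;1728t\right),\qquad \mathcal F_2(t)={}_2F_1\!\left(-\tfrac1{12},\tfrac7{12};1;1728t\right),$$ let $(1-1728t)^{1/2}$ be the square root with constant term $1$, and let $$\mathcal F=\mathbb C\big[\mathcal F_1\mathcal F_2,\ \mathcal F_1^4,\ (1-1728t)^{1/2}\mathcal F_1^6\big]\subset\mathbb C[\![t]\!],$$ with the three generators given the weights $2,4,6$; the weight-$w$ part $\mathcal F_w$ is the span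 of the monomials of weight $w$ in the generators. Let $D_{\mathcal F}=(1-1728t)^{1/2}\mathcal F_1(t)^2\,t\frac{d}{dt}$. Then: (1) $QM_*(\Gamma)=\bigoplus_w QM_w$ and $\mathcal F=\bigoplus_w\mathcal F_w$ are graded $\mathbb C$-algebras. The ring $QM_*(\Gamma)$ is closed under $D$ and $\mathcal F$ is closed under $D_{\mathcal F}$; on these rings $D$ and $D_{\mathcal F}$ are $\mathbb C$-linear derivations that raise the weight by $2$. (2) There is an isomorphism of $\mathbb C$-algebras $\Phi:QM_*(\Gamma)\to\mathcal F$ with $\Phi(E_2)=\mathcal F_1\mathcal F_2$, $\Phi(E_4)=\mathcal F_1^4$, $\Phi(E_6)=(1-1728t)^{1/2}\mathcal F_1^6$, which is inverse to the substitution $t=1/j$: there is a constant $Y$ such that for every $f\in QM_*(\Gamma)$ and every $\tau$ with $\operatorname{Im}\tau>Y$ the power series $\Phi(f)(t)$ converges at $t=1/j(\tau)$, with sum $f(\tau)$. (3) $\Phi$ is an isomorphism of graded differential algebras: for every $w$ and every $f\in QM_*(\Gamma)$ one has $f\in QM_w$ if and only if $\Phi(f)\in\mathcal F_w$, and $\Phi(Df)=D_{\mathcal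 F}(\Phi(f))$. -/

import Mathlib

noncomputable section

namespace QuasiModular

open UpperHalfPlane PowerSeries

/-! ### Graded subalgebras generated by elements of weights 2, 4, 6 -/

/-- The subalgebra `ℂ[a, b, c]` of `A`. -/
def genAlg {A : Type*} [CommRing A] [Algebra ℂ A] (a b c : A) : Subalgebra ℂ A :=
  Algebra.adjoin ℂ {a, b, c}

/-- The weight `w` part of `ℂ[a, b, c]`, where `a`, `b`, `c` have weights `2`, `4`, `6`:
the elements of `ℂ[a, b, c]` that are linear combinations of the monomials
`a ^ l * b ^ m * c ^ n` with `2 * l + 4 * m + 6 * n = w`. -/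
def genPiece {A : Type*} [CommRing A] [Algebra ℂ A] (a b c : A) (w : ℕ) :
    Submodule ℂ (genAlg a b c) :=
  (Submodule.span ℂ {x : A | ∃ l m n : ℕ, 2 * l + 4 * m + 6 * n = w ∧
    x = a ^ l * b ^ m * c ^ n}).comap (genAlg a b c).val.toLinearMap

/-! ### Quasimodular forms on `SL₂(ℤ)` -/

/-- The Eisenstein series `E₂ = 1 - 24 q - ...`, as a function on the upper half plane. -/
def e2 : ℍ → ℂ := EisensteinSeries.E2

/-- The Eisenstein series `E₄ = 1 + 240 q + ...`, as a function on the upper half plane. -/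
def e4 : ℍ → ℂ := ⇑ModularForm.E₄

/-- The Eisenstein series `E₆ = 1 - 504 q - ...`, as a function on the upper half plane. -/
def e6 : ℍ → ℂ := ⇑ModularForm.E₆

/-- The ring `ℂ[E₂, E₄, E₆]` of quasimodular forms on `SL₂(ℤ)`, as a ring of functions on the
upper half plane. -/
abbrev QM : Subalgebra ℂ (ℍ → ℂ) := genAlg e2 e4 e6

/-- The quasimodular forms of weight `w`. -/
abbrev QMw (w : ℕ) : Submodule ℂ QM := genPiece e2 e4 e6 w

/-- The elliptic modular function `j = E₄³ / Δ`, where `Δ = q ∏ (1 - q ^ n) ^ 24`. -/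
def jInv (τ : ℍ) : ℂ := e4 τ ^ 3 / ModularForm.discriminant τ

/-! ### The hypergeometric side -/

/-- The power series `₂F₁(a, b; c; 1728 t)` in `t`. -/
def hyp1728 (a b c : ℂ) : ℂ⟦X⟧ :=
  rescale (1728 : ℂ) (PowerSeries.mk fun n => ordinaryHypergeometricCoefficient a b c n)

/-- `₂F₁(1/12, 5/12; 1; 1728 t)` -/
def F1 : ℂ⟦X⟧ := hyp1728 (1 / 12) (5 / 12) 1

/-- `₂F₁(-1/12, 7/12; 1; 1728 t)` -/
def F2 : ℂ⟦X⟧ := hyp1728 (-1 / 12) (7 / 12) 1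

/-- The power series `(1 - 1728 t) ^ (1/2)` (binomial expansion, constant term `1`). -/
def sqrtSeries : ℂ⟦X⟧ := rescale (-1728 : ℂ) (binomialSeries ℂ (1 / 2 : ℂ))

/-- The ring `ℂ[F₁ F₂, F₁ ^ 4, (1 - 1728 t) ^ (1/2) F₁ ^ 6]` of power series in `t`. -/
abbrev FF : Subalgebra ℂ ℂ⟦X⟧ := genAlg (F1 * F2) (F1 ^ 4) (sqrtSeries * F1 ^ 6)

/-- The weight `w` part of `FF`. -/
abbrev FFw (w : ℕ) : Submodule ℂ FF :=
  genPiece (F1 * F2) (F1 ^ 4) (sqrtSeries * F1 ^ 6) w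

/-- The derivation `(1 - 1728 t) ^ (1/2) F₁ ^ 2 t d/dt` of `ℂ⟦t⟧`. -/
def derivF : Derivation ℂ ℂ⟦X⟧ ℂ⟦X⟧ :=
  (sqrtSeries * F1 ^ 2 * (X : ℂ⟦X⟧)) • PowerSeries.derivative ℂ

end QuasiModular

end

noncomputable section

namespace QuasiModular

open UpperHalfPlane PowerSeries

/-! ### Formal identities between the hypergeometric series -/

/-! Both triples of generators solve Ramanujan's differential system, and the theorem follows from a
uniqueness statement for that system.

On the formal side let `θ = t d/dt` and let `s` be the square root series. The hypergeometric
equation of `F1` is equivalent to the pair `F2 = s (F1 + 12 θ F1)` and `F1 = s (F2 - 12 θ F2)`. With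
`s ^ 2 = 1 - 1728 t` this gives Ramanujan's identities for `derivF` (`derivF_gen2`, `derivF_gen4`,
`derivF_gen6`). On the modular side they hold because the Serre derivatives of `E₂`, `E₄`, `E₆` lie
in one-dimensional spaces of modular forms of weights 4, 6, 8.

To compare the two, substitute `t = 1/j` in the three series, obtaining functions `a`, `b`, `e` on a
half plane. Since `D(1/j) = (1/j) E₆/E₄`, they satisfy Ramanujan's system up to the factor `μ =
(E₆/E₄) / (s F1 ^ 2)`, and `e²/b³ = 1 - 1728/j = E₆²/E₄³`. Hence `E₄ = μ² b` and `E₆ = μ³ e`, and `v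
= E₂ - μ a` solves `v' = const · v²`. The nonzero solutions are not 1-periodic, so `v = 0`; then `μ'
= 0`, and the limit at infinity gives `μ = 1` (`ramanujan_unique`, `eisenstein_eq_ev`).

The isomorphism is obtained from its graph `pairs`, the algebra generated by the three pairs of
generators. Both projections are injective by identity theorems, so algebraic independence of the
generators is never needed. The graph is stable under the pair of derivations, which makes the
isomorphism differential. Independence of the weights is proved for quasimodular forms from their
behaviour under `τ ↦ -1/(τ + n)` as `n → ∞`, and is then carried over to the power series. -/

/-- The Euler operator `t d/dt` on power series. -/
def euler : Derivation ℂ ℂ⟦X⟧ ℂ⟦X⟧ := (X : ℂ⟦X⟧) • PowerSeries.derivative ℂ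

lemma euler_apply (g : ℂ⟦X⟧) : euler g = X * derivative ℂ g := rfl

lemma derivF_apply (g : ℂ⟦X⟧) : derivF g = sqrtSeries * F1 ^ 2 * euler g := by
  simp [derivF, euler_apply, mul_assoc]

@[simp]
lemma coeff_euler (g : ℂ⟦X⟧) (n : ℕ) : coeff n (euler g) = n * coeff n g := by
  rw [euler_apply]
  cases n with
  | zero => simp
  | succ n => rw [coeff_succ_X_mul, coeff_derivative]; push_cast; ring

lemma coeff_zero_hyp1728 (a b : ℂ) : coeff 0 (hyp1728 a b 1) = 1 := by
  simp [hyp1728, ordinaryHypergeometricCoefficient]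

lemma coeff_succ_hyp1728 (a b : ℂ) (n : ℕ) :
    ((n : ℂ) + 1) ^ 2 * coeff (n + 1) (hyp1728 a b 1) =
      1728 * (a + n) * (b + n) * coeff n (hyp1728 a b 1) := by
  have h1 : ((n : ℂ) + 1) ≠ 0 := by exact_mod_cast n.succ_ne_zero
  have h2 : ((n.factorial : ℕ) : ℂ) ≠ 0 := by exact_mod_cast n.factorial_ne_zero
  simp only [hyp1728, ordinaryHypergeometricCoefficient, coeff_rescale, coeff_mk,
    ascPochhammer_succ_eval, ascPochhammer_eval_one, Nat.factorial_succ]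
  push_cast
  field_simp
  ring

lemma hyp1728_unique (a b : ℂ) {G : ℂ⟦X⟧} (h0 : coeff 0 G = 1)
    (h : ∀ n : ℕ, ((n : ℂ) + 1) ^ 2 * coeff (n + 1) G = 1728 * (a + n) * (b + n) * coeff n G) :
    G = hyp1728 a b 1 := by
  ext n
  induction n with
  | zero => rw [h0, coeff_zero_hyp1728]
  | succ n ih =>
    have h1 : ((n : ℂ) + 1) ^ 2 ≠ 0 := pow_ne_zero _ (by exact_mod_cast n.succ_ne_zero)
    apply mul_left_cancel₀ h1
    rw [h, coeff_succ_hyp1728, ih]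

/-- The coefficient recursion read as a differential equation: `144 (n + 1/12) (n + 5/12) = 144 n² +
72 n + 5`. The parameters of `F2` give the same polynomial with `-7` in place of `5`. -/
lemma F1_ode : 144 * euler (euler F1) =
    1728 * (X * (144 * euler (euler F1) + 72 * euler F1 + 5 * F1)) := by
  ext n
  cases n with
  | zero => simp [show (144 : ℂ⟦X⟧) = C 144 from rfl, show (1728 : ℂ⟦X⟧) = C 1728 from rfl]
  | succ n =>
    simp only [show (144 : ℂ⟦X⟧) = C 144 from rfl, show (1728 : ℂ⟦X⟧) = C 1728 from rfl,
      show (72 : ℂ⟦X⟧) = C 72 from rfl, show (5 : ℂ⟦X⟧) = C 5 from rfl, coeff_C_mul,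
      coeff_succ_X_mul, map_add, coeff_euler]
    have := coeff_succ_hyp1728 (1 / 12) (5 / 12) n
    rw [← F1] at this
    push_cast
    linear_combination 144 * this

lemma eq_F2_of_ode {G : ℂ⟦X⟧} (h0 : coeff 0 G = 1) (h : 144 * euler (euler G) =
    1728 * (X * (144 * euler (euler G) + 72 * euler G - 7 * G))) : G = F2 := by
  refine hyp1728_unique _ _ h0 fun n => ?_
  have := congrArg (coeff (n + 1)) h
  simp only [show (144 : ℂ⟦X⟧) = C 144 from rfl, show (1728 : ℂ⟦X⟧) = C 1728 from rfl,
      show (72 : ℂ⟦X⟧) = C 72 from rfl, show (7 : ℂ⟦X⟧) = C 7 from rfl, coeff_C_mul,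
      coeff_succ_X_mul, map_add, map_sub, coeff_euler] at this
  push_cast at this
  linear_combination this / 144

lemma sqrtSeries_sq : sqrtSeries ^ 2 = 1 - 1728 * X := by
  have h : PowerSeries.binomialSeries ℂ (1 / 2 : ℂ) * PowerSeries.binomialSeries ℂ (1 / 2 : ℂ) =
      1 + X := by
    rw [← binomialSeries_add]
    have := binomialSeries_nat (R := ℂ) (A := ℂ) 1
    norm_num at this ⊢
    exact this
  rw [sqrtSeries, sq, ← map_mul, h, map_add, map_one, rescale_X]
  simp [show (1728 : ℂ⟦X⟧) = C 1728 from rfl, sub_eq_add_neg]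

lemma coeff_zero_sqrtSeries : coeff 0 sqrtSeries = 1 := by
  simp [sqrtSeries]

lemma coeff_zero_F1 : coeff 0 F1 = 1 := coeff_zero_hyp1728 _ _

lemma euler_natCast_mul (n : ℕ) (g : ℂ⟦X⟧) : euler (n * g) = n * euler g := by
  simp

lemma euler_X : euler X = X := by simp [euler_apply]

lemma sqrtSeries_mul_euler : sqrtSeries * euler sqrtSeries = -864 * X := by
  have h := congrArg euler sqrtSeries_sq
  rw [sq, Derivation.leibniz, map_sub, Derivation.map_one_eq_zero, ← Nat.cast_ofNat (n := 1728),
    euler_natCast_mul, euler_X] at h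
  have h2 : (2 : ℂ⟦X⟧) ≠ 0 := fun h => by
    simpa [show (2 : ℂ⟦X⟧) = C 2 from rfl] using congrArg constantCoeff h
  apply mul_left_cancel₀ h2
  simp only [smul_eq_mul, Nat.cast_ofNat] at h
  linear_combination h

/-- Applying `s (1 - 12 t d/dt)` to `s (1 + 12 t d/dt) F₁` gives back `F₁`. -/
lemma F1_eq_of_eq {G : ℂ⟦X⟧} (hG : G = sqrtSeries * (F1 + 12 * euler F1)) :
    F1 = sqrtSeries * (G - 12 * euler G) := by
  have hd : euler G = euler sqrtSeries * (F1 + 12 * euler F1) +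
      sqrtSeries * (euler F1 + 12 * euler (euler F1)) := by
    have := euler_natCast_mul 12 (euler F1)
    simp only [Nat.cast_ofNat] at this
    rw [hG, Derivation.leibniz, map_add, this]
    simp only [smul_eq_mul]
    ring
  rw [hd, hG]
  linear_combination F1_ode - (F1 - 144 * euler (euler F1)) * sqrtSeries_sq +
    12 * (F1 + 12 * euler F1) * sqrtSeries_mul_euler

/-- Put `L± = s (1 ± 12 θ)`. The equation of `F1` says `L₋ L₊ F1 = F1`, so `G = L₊ F1` satisfies `L₊
L₋ G = G`, which is the equation of `F2`. The constant term 1 then singles out `F2`. -/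
lemma F2_eq : F2 = sqrtSeries * (F1 + 12 * euler F1) := by
  obtain ⟨G, hG⟩ : ∃ G, G = sqrtSeries * (F1 + 12 * euler F1) := ⟨_, rfl⟩
  rw [← hG]
  have h1 := F1_eq_of_eq hG
  have hd : euler F1 = euler sqrtSeries * (G - 12 * euler G) +
      sqrtSeries * (euler G - 12 * euler (euler G)) := by
    have := euler_natCast_mul 12 (euler G)
    simp only [Nat.cast_ofNat] at this
    nth_rw 1 [h1]
    rw [Derivation.leibniz, map_sub, this]
    simp only [smul_eq_mul]
    ring
  refine (eq_F2_of_ode ?_ ?_).symm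
  · rw [hG]
    simp [coeff_zero_sqrtSeries, coeff_zero_F1, show (12 : ℂ⟦X⟧) = C 12 from rfl, coeff_mul,
      -coeff_zero_eq_constantCoeff]
  · rw [hd] at hG
    nth_rw 1 [h1] at hG
    linear_combination hG + (G - 144 * euler (euler G)) * sqrtSeries_sq +
      12 * (G - 12 * euler G) * sqrtSeries_mul_euler

lemma F1_eq : F1 = sqrtSeries * (F2 - 12 * euler F2) := F1_eq_of_eq F2_eq

/-- Here `12 s θ F1 = F2 - s F1` and `12 s θ F2 = s F2 - F1`; in the product rule the two terms `s
F1 F2` cancel. -/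
lemma derivF_gen2 : 12 * derivF (F1 * F2) = (F1 * F2) ^ 2 - F1 ^ 4 := by
  rw [derivF_apply, Derivation.leibniz]
  simp only [smul_eq_mul]
  linear_combination -F1 ^ 2 * F2 * F2_eq + F1 ^ 3 * F1_eq

lemma derivF_gen4 : 3 * derivF (F1 ^ 4) = F1 * F2 * F1 ^ 4 - sqrtSeries * F1 ^ 6 := by
  rw [derivF_apply, Derivation.leibniz_pow]
  simp only [smul_eq_mul, nsmul_eq_mul]
  push_cast
  linear_combination -F1 ^ 5 * F2_eq

lemma derivF_gen6 : 2 * derivF (sqrtSeries * F1 ^ 6) =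
    F1 * F2 * (sqrtSeries * F1 ^ 6) - (F1 ^ 4) ^ 2 := by
  rw [derivF_apply, Derivation.leibniz, Derivation.leibniz_pow]
  simp only [smul_eq_mul, nsmul_eq_mul]
  push_cast
  linear_combination -sqrtSeries * F1 ^ 7 * F2_eq + 2 * F1 ^ 8 * sqrtSeries_mul_euler -
    F1 ^ 8 * sqrtSeries_sq

/-! ### Evaluation of convergent power series -/

/-- The power series `g` converges absolutely on the disc of radius `r`. -/
def ConvOn (r : ℝ) (g : ℂ⟦X⟧) : Prop :=
  ∀ x : ℂ, ‖x‖ < r → Summable fun n => ‖coeff n g * x ^ n‖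

/-- The sum of a power series at a point. -/
def ev (g : ℂ⟦X⟧) (x : ℂ) : ℂ := ∑' n, coeff n g * x ^ n

section ConvOn

variable {r : ℝ} {g h : ℂ⟦X⟧} {x : ℂ}

lemma ConvOn.hasSum (hg : ConvOn r g) (hx : ‖x‖ < r) :
    HasSum (fun n => coeff n g * x ^ n) (ev g x) :=
  (hg x hx).of_norm.hasSum

lemma ConvOn.C (c : ℂ) : ConvOn r (C c) := fun x _ => by
  refine summable_of_ne_finset_zero (s := {0}) fun n hn => ?_
  simp [coeff_C, show n ≠ 0 by simpa using hn]

@[simp]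
lemma ev_C (c x : ℂ) : ev (C c) x = c := by
  rw [ev, tsum_eq_single 0 fun n hn => by simp [coeff_C, hn]]
  simp

lemma ConvOn.add (hg : ConvOn r g) (hh : ConvOn r h) : ConvOn r (g + h) := fun x hx => by
  refine ((hg x hx).add (hh x hx)).of_nonneg_of_le (fun _ => norm_nonneg _) fun n => ?_
  rw [map_add, add_mul]
  exact norm_add_le _ _

lemma ev_add (hg : ConvOn r g) (hh : ConvOn r h) (hx : ‖x‖ < r) :
    ev (g + h) x = ev g x + ev h x := by
  rw [ev, ev, ev, ← (hg.hasSum hx).summable.tsum_add (hh.hasSum hx).summable]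
  simp [add_mul]

lemma coeff_mul_mul_pow (g h : ℂ⟦X⟧) (x : ℂ) (n : ℕ) : coeff n (g * h) * x ^ n =
    ∑ kl ∈ Finset.HasAntidiagonal.antidiagonal n, coeff kl.1 g * x ^ kl.1 * (coeff kl.2 h * x ^ kl.2) := by
  rw [coeff_mul, Finset.sum_mul]
  refine Finset.sum_congr rfl fun kl hkl => ?_
  rw [← Finset.HasAntidiagonal.mem_antidiagonal.1 hkl, pow_add]
  ring

lemma ConvOn.mul (hg : ConvOn r g) (hh : ConvOn r h) : ConvOn r (g * h) := fun x hx => by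
  simp_rw [coeff_mul_mul_pow]
  exact summable_norm_sum_mul_antidiagonal_of_summable_norm (f := fun n => coeff n g * x ^ n)
    (g := fun n => coeff n h * x ^ n) (hg x hx) (hh x hx)

lemma ev_mul (hg : ConvOn r g) (hh : ConvOn r h) (hx : ‖x‖ < r) :
    ev (g * h) x = ev g x * ev h x := by
  simp_rw [ev, coeff_mul_mul_pow]
  exact (tsum_mul_tsum_eq_tsum_sum_antidiagonal_of_summable_norm (hg x hx) (hh x hx)).symm

lemma ConvOn.pow (hg : ConvOn r g) (n : ℕ) : ConvOn r (g ^ n) := by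
  induction n with
  | zero => simpa using ConvOn.C (r := r) 1
  | succ n ih => rw [pow_succ]; exact ih.mul hg

lemma ev_pow (hg : ConvOn r g) (hx : ‖x‖ < r) (n : ℕ) : ev (g ^ n) x = ev g x ^ n := by
  induction n with
  | zero => simpa using ev_C 1 x
  | succ n ih => rw [pow_succ, pow_succ, ev_mul (hg.pow n) hg hx, ih]

/-- For `x` in the disc of convergence, the derived series is dominated by a summable sequence on a
smaller disc containing `x`. -/
lemma ConvOn.exists_summable (hg : ConvOn r g) (hx : ‖x‖ < r) :
    ∃ ρ : ℝ, ‖x‖ < ρ ∧ ρ < r ∧ Summable fun n : ℕ => n * (‖coeff n g‖ * ρ ^ n) := by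
  obtain ⟨ρ, hxρ, hρr⟩ := exists_between hx
  obtain ⟨σ, hρσ, hσr⟩ := exists_between hρr
  have hρ0 : 0 < ρ := (norm_nonneg x).trans_lt hxρ
  have hσ0 : 0 < σ := hρ0.trans hρσ
  refine ⟨ρ, hxρ, hρr, ?_⟩
  -- Convergence at the larger radius `σ` bounds `‖coeff n g‖ σ ^ n`; the geometric factor `(ρ / σ)
  -- ^ n` then absorbs the extra `n`.
  have h1 := hg (σ : ℂ) (by rwa [Complex.norm_real, Real.norm_of_nonneg hσ0.le])
  obtain ⟨K, hK⟩ := h1.tendsto_atTop_zero.bddAbove_range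
  have h2 : Summable fun n : ℕ => K * ((n : ℝ) ^ 1 * (ρ / σ) ^ n) := by
    refine (summable_pow_mul_geometric_of_norm_lt_one 1 ?_).mul_left K
    rw [Real.norm_of_nonneg (by positivity), div_lt_one hσ0]
    exact hρσ
  refine h2.of_nonneg_of_le (fun n => by positivity) fun n => ?_
  have h3 : ‖coeff n g‖ * σ ^ n ≤ K := by
    have := hK (Set.mem_range_self n)
    simpa [abs_of_pos hσ0] using this
  calc (n : ℝ) * (‖coeff n g‖ * ρ ^ n) = (‖coeff n g‖ * σ ^ n) * (n * (ρ / σ) ^ n) := by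
        rw [div_pow]; field_simp
    _ ≤ K * (n * (ρ / σ) ^ n) := by gcongr
    _ = _ := by rw [pow_one]

lemma ConvOn.euler (hg : ConvOn r g) : ConvOn r (euler g) := fun x hx => by
  obtain ⟨ρ, hxρ, -, hs⟩ := hg.exists_summable hx
  refine hs.of_nonneg_of_le (fun _ => norm_nonneg _) fun n => ?_
  rw [coeff_euler, mul_assoc, norm_mul, norm_mul, norm_pow, Complex.norm_natCast]
  gcongr

lemma ConvOn.hasDerivAt (hg : ConvOn r g) (hx : ‖x‖ < r) :
    ∃ d : ℂ, HasDerivAt (ev g) d x ∧ ev (QuasiModular.euler g) x = x * d := by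
  obtain ⟨ρ, hxρ, hρr, hs⟩ := hg.exists_summable hx
  have hρ0 : 0 < ρ := (norm_nonneg x).trans_lt hxρ
  refine ⟨∑' n : ℕ, coeff n g * (n * x ^ (n - 1)), ?_, ?_⟩
  · refine hasDerivAt_tsum_of_isPreconnected (t := Metric.ball 0 ρ) (y₀ := x)
      (hs.mul_left ρ⁻¹) Metric.isOpen_ball (convex_ball _ _).isPreconnected
      (fun n y _ => (hasDerivAt_pow n y).const_mul _) (fun n y hy => ?_) (by simpa using hxρ)
      (hg.hasSum hx).summable (by simpa using hxρ)
    rw [mem_ball_zero_iff] at hy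
    cases n with
    | zero => simp
    | succ n =>
      rw [norm_mul, norm_mul, norm_pow, Complex.norm_natCast, Nat.add_sub_cancel]
      calc ‖coeff (n + 1) g‖ * (((n + 1 : ℕ) : ℝ) * ‖y‖ ^ n)
          ≤ ‖coeff (n + 1) g‖ * (((n + 1 : ℕ) : ℝ) * ρ ^ n) := by gcongr
        _ = _ := by rw [pow_succ]; field_simp
  · rw [ev, ← tsum_mul_left]
    refine tsum_congr fun n => ?_
    rw [coeff_euler]
    cases n with
    | zero => simp
    | succ n => rw [Nat.add_sub_cancel, pow_succ]; ring

lemma ConvOn.continuousAt (hg : ConvOn r g) (hx : ‖x‖ < r) : ContinuousAt (ev g) x :=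
  (hg.hasDerivAt hx).choose_spec.1.continuousAt

lemma ev_zero (g : ℂ⟦X⟧) : ev g 0 = coeff 0 g := by
  rw [ev, tsum_eq_single 0 fun n hn => by simp [hn]]
  simp

/-- A convergent power series that vanishes along a filter converging to `0` in the punctured plane
is zero. -/
lemma ConvOn.eq_zero (hr : 0 < r) (hg : ConvOn r g) {ι : Type*} {l : Filter ι} [l.NeBot]
    {u : ι → ℂ} (hu : Filter.Tendsto u l (nhdsWithin 0 {0}ᶜ)) (h0 : ∀ᶠ i in l, ev g (u i) = 0) :
    g = 0 := by
  have hp : HasFPowerSeriesAt (ev g) (FormalMultilinearSeries.ofScalars ℂ fun n => coeff n g) 0 := by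
    refine ⟨ENNReal.ofReal r, ?_, by simpa using hr, fun {y} hy => ?_⟩
    · refine ENNReal.le_of_forall_nnreal_lt fun ρ hρ => ?_
      refine FormalMultilinearSeries.le_radius_of_summable _ ?_
      have hρ' : (ρ : ℝ) < r := by
        rw [← ENNReal.ofReal_coe_nnreal, ENNReal.ofReal_lt_ofReal_iff hr] at hρ
        exact hρ
      simpa [FormalMultilinearSeries.ofScalars_norm] using hg (ρ : ℝ) (by simpa using hρ')
    · have hy' : ‖y‖ < r := by simpa [hr] using hy
      simpa [mul_comm] using hg.hasSum hy'
  have h1 : ∃ᶠ z in nhdsWithin 0 {0}ᶜ, ev g z = 0 := hu.frequently h0.frequently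
  have h2 := hp.analyticAt.frequently_zero_iff_eventually_zero.1 h1
  have h3 := (hp.congr h2).eq_zero
  ext n
  have := congrArg (fun p => FormalMultilinearSeries.coeff p n) h3
  rw [FormalMultilinearSeries.coeff_ofScalars] at this
  exact this.trans rfl

end ConvOn

lemma convOn_of_norm_coeff_le {g : ℂ⟦X⟧} (h : ∀ n, ‖coeff n g‖ ≤ 1728 ^ n) :
    ConvOn (1 / 1728) g := fun x hx => by
  have h1 : Summable fun n : ℕ => (1728 * ‖x‖) ^ n :=
    summable_geometric_of_lt_one (by positivity) (by linarith)
  refine h1.of_nonneg_of_le (fun _ => norm_nonneg _) fun n => ?_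
  rw [norm_mul, norm_pow, mul_pow]
  gcongr
  exact h n

/-- Consecutive coefficients have ratio `1728 (a + n) (b + n) / (n + 1)²`, of norm at most 1728. -/
lemma norm_coeff_hyp1728_le {a b : ℝ} (ha : |a| ≤ 1) (hb : |b| ≤ 1) (n : ℕ) :
    ‖coeff n (hyp1728 a b 1)‖ ≤ 1728 ^ n := by
  induction n with
  | zero => rw [coeff_zero_hyp1728]; simp
  | succ n ih =>
    have key := congrArg norm (coeff_succ_hyp1728 a b n)
    have e : ∀ c : ℝ, |c| ≤ 1 → ‖(c : ℂ) + n‖ ≤ n + 1 := fun c hc => by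
      refine (norm_add_le _ _).trans ?_
      rw [Complex.norm_real, Complex.norm_natCast, Real.norm_eq_abs]
      linarith
    have e1 : ‖(n : ℂ) + 1‖ = n + 1 := by exact_mod_cast Complex.norm_natCast (n + 1)
    rw [norm_mul, norm_mul, norm_mul, norm_mul, norm_pow, e1, Complex.norm_ofNat] at key
    refine le_of_mul_le_mul_left (a := ((n : ℝ) + 1) ^ 2) ?_ (by positivity)
    rw [key]
    calc 1728 * ‖(a : ℂ) + n‖ * ‖(b : ℂ) + n‖ * ‖coeff n (hyp1728 a b 1)‖
        ≤ 1728 * ((n : ℝ) + 1) * (n + 1) * 1728 ^ n := by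
          gcongr
          exacts [e a ha, e b hb]
      _ = _ := by ring

lemma convOn_F1 : ConvOn (1 / 1728) F1 := convOn_of_norm_coeff_le fun n => by
  have := norm_coeff_hyp1728_le (a := 1 / 12) (b := 5 / 12)
    (by rw [abs_of_nonneg] <;> norm_num) (by rw [abs_of_nonneg] <;> norm_num) n
  push_cast at this
  exact this

lemma convOn_F2 : ConvOn (1 / 1728) F2 := convOn_of_norm_coeff_le fun n => by
  have := norm_coeff_hyp1728_le (a := -1 / 12) (b := 7 / 12)
    (by rw [abs_of_nonpos] <;> norm_num) (by rw [abs_of_nonneg] <;> norm_num) n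
  push_cast at this
  exact this

lemma coeff_succ_sqrtSeries (n : ℕ) :
    ((n : ℂ) + 1) * coeff (n + 1) sqrtSeries = 1728 * (n - 1 / 2) * coeff n sqrtSeries := by
  -- Multiplying `s θ s = -864 t` by `s` and using `s² = 1 - 1728 t` gives a linear equation, hence
  -- a two-term recursion.
  have h : euler sqrtSeries - 1728 * (X * euler sqrtSeries) = -864 * (X * sqrtSeries) := by
    linear_combination sqrtSeries * sqrtSeries_mul_euler - euler sqrtSeries * sqrtSeries_sq
  have := congrArg (coeff (n + 1)) h
  simp only [show (-864 : ℂ⟦X⟧) = C (-864) by simp; rfl, show (1728 : ℂ⟦X⟧) = C 1728 from rfl,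
    map_sub, coeff_C_mul, coeff_succ_X_mul, coeff_euler] at this
  push_cast at this
  linear_combination this

lemma convOn_sqrtSeries : ConvOn (1 / 1728) sqrtSeries := convOn_of_norm_coeff_le fun n => by
  induction n with
  | zero => rw [coeff_zero_sqrtSeries]; simp
  | succ n ih =>
    have key := congrArg norm (coeff_succ_sqrtSeries n)
    have e : ‖(n : ℂ) - 1 / 2‖ ≤ n + 1 := by
      refine (norm_sub_le _ _).trans ?_
      rw [Complex.norm_natCast]
      norm_num
    have e1 : ‖(n : ℂ) + 1‖ = n + 1 := by exact_mod_cast Complex.norm_natCast (n + 1)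
    rw [norm_mul, norm_mul, norm_mul, e1, Complex.norm_ofNat] at key
    refine le_of_mul_le_mul_left (a := (n : ℝ) + 1) ?_ (by positivity)
    rw [key]
    calc 1728 * ‖(n : ℂ) - 1 / 2‖ * ‖coeff n sqrtSeries‖
        ≤ 1728 * ((n : ℝ) + 1) * 1728 ^ n := by gcongr
      _ = _ := by ring

section

/-! ### Ramanujan's identities -/

open Filter Topology Derivative EisensteinSeries
open scoped Manifold MatrixGroups ModularForm

section Limits

variable {f : ℍ → ℂ}

lemma tendsto_cuspFunction_zero (hper : Function.Periodic (f ∘ ofComplex) (1 : ℝ)) (hf : MDiff f)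
    (hbdd : IsBoundedAtImInfty f) : Tendsto f atImInfty (𝓝 (cuspFunction 1 f 0)) := by
  have h := (analyticAt_cuspFunction_zero one_pos hper hf hbdd).continuousAt.tendsto.comp
    (qParam_tendsto_atImInfty one_pos)
  refine h.congr fun τ => ?_
  exact eq_cuspFunction τ one_ne_zero hper

/-- In the coordinate `q` the normalized derivative is `q F'(q)`, where the cusp function `F` is
analytic at `q = 0`. -/
lemma tendsto_deriv_atImInfty (hper : Function.Periodic (f ∘ ofComplex) (1 : ℝ)) (hf : MDiff f)
    (hbdd : IsBoundedAtImInfty f) : Tendsto (normalizedDerivOfComplex f) atImInfty (𝓝 0) := by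
  have hc : ContinuousAt (deriv (cuspFunction 1 f)) 0 :=
    (analyticAt_cuspFunction_zero one_pos hper hf hbdd).deriv.continuousAt
  have hq := qParam_tendsto_atImInfty one_pos
  have h := hq.mul (hc.tendsto.comp hq)
  rw [zero_mul] at h
  refine h.congr fun τ => ?_
  have h1 : (f ∘ ofComplex) = cuspFunction 1 f ∘ Function.Periodic.qParam 1 := by
    funext z
    exact (Function.Periodic.eq_cuspFunction one_ne_zero hper z).symm
  have h2 : HasDerivAt (Function.Periodic.qParam 1)
      (2 * Real.pi * Complex.I * Function.Periodic.qParam 1 τ) (τ : ℂ) := by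
    have h3 : HasDerivAt (fun z : ℂ => 2 * Real.pi * Complex.I * z / ((1 : ℝ) : ℂ))
        (2 * Real.pi * Complex.I) (τ : ℂ) := by
      simpa using (hasDerivAt_id (τ : ℂ)).const_mul (2 * Real.pi * Complex.I)
    rw [mul_comm]
    exact h3.cexp
  have h4 := (differentiableAt_cuspFunction one_pos hper hf hbdd
    (Function.Periodic.norm_qParam_lt_one one_pos τ.im_pos)).hasDerivAt
  rw [normalizedDerivOfComplex, h1, (h4.comp (τ : ℂ) h2).deriv, Function.comp_apply]
  field_simp

end Limits

section ModularForms

variable {k : ℤ}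

lemma bounded_of_modularForm (f : ModularForm 𝒮ℒ k) : IsBoundedAtImInfty f :=
  have : Fact (IsCusp OnePoint.infty 𝒮ℒ) :=
    ⟨Subgroup.isCusp_of_mem_strictPeriods one_pos one_mem_strictPeriods_SL⟩
  ModularFormClass.bdd_at_infty f

lemma periodic_of_modularForm (f : ModularForm 𝒮ℒ k) :
    Function.Periodic (f ∘ ofComplex) (1 : ℝ) :=
  SlashInvariantFormClass.periodic_comp_ofComplex f one_mem_strictPeriods_SL

lemma tendsto_eisenstein {k : ℕ} (hk : 3 ≤ k) (hk2 : Even k) :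
    Tendsto (ModularForm.E hk) atImInfty (𝓝 1) := by
  have h := tendsto_cuspFunction_zero (periodic_of_modularForm (ModularForm.E hk))
    (ModularForm.E hk).holo' (bounded_of_modularForm _)
  have h0 := E_qExpansion_coeff_zero hk hk2
  rw [qExpansion_coeff] at h0
  simp only [Nat.factorial_zero, Nat.cast_one, inv_one, iteratedDeriv_zero, one_mul] at h0
  rwa [h0] at h

/-- In a one-dimensional space of modular forms, a form is determined by its value at infinity. -/
lemma eq_smul_of_tendsto (hrank : Module.rank ℂ (ModularForm 𝒮ℒ k) = 1) {f g : ModularForm 𝒮ℒ k}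
    {c : ℂ} (hg : Tendsto g atImInfty (𝓝 1)) (hf : Tendsto f atImInfty (𝓝 c)) (τ : ℍ) :
    f τ = c * g τ := by
  have hg0 : g ≠ 0 := by
    rintro rfl
    exact one_ne_zero (tendsto_nhds_unique hg tendsto_const_nhds)
  obtain ⟨d, hd⟩ := (finrank_eq_one_iff_of_nonzero' g hg0).mp
    (Module.rank_eq_one_iff_finrank_eq_one.mp hrank) f
  have hfd : ∀ τ, f τ = d * g τ := fun τ => by rw [← hd]; rfl
  have h1 : Tendsto f atImInfty (𝓝 (d * 1)) := (hg.const_mul d).congr fun τ => (hfd τ).symm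
  rw [hfd τ, tendsto_nhds_unique hf h1, mul_one]

/-- A modular form from a holomorphic function invariant under the slash action and converging at
infinity. -/
def modularFormOfTendsto (f : ℍ → ℂ) (hf : MDiff f) (hinv : ∀ γ : SL(2, ℤ), f ∣[k] γ = f) {c : ℂ}
    (hc : Tendsto f atImInfty (𝓝 c)) : ModularForm 𝒮ℒ k where
  toFun := f
  slash_action_eq' := by
    rintro _ ⟨γ, rfl⟩
    exact hinv γ
  holo' := hf
  bdd_at_cusps' hcusp := by
    rw [OnePoint.isBoundedAt_iff_forall_SL2Z hcusp]
    intro γ _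
    rw [hinv γ]
    exact hc.isBigO_one ℝ

lemma slash_modularForm (f : ModularForm 𝒮ℒ k) (γ : SL(2, ℤ)) : (f : ℍ → ℂ) ∣[k] γ = f :=
  f.slash_action_eq' _ ⟨γ, rfl⟩

end ModularForms

lemma mdifferentiable_e2 : MDiff e2 := E2_mdifferentiable

lemma mdifferentiable_e4 : MDiff e4 := ModularForm.E₄.holo'

lemma mdifferentiable_e6 : MDiff e6 := ModularForm.E₆.holo'

lemma periodic_e4 : Function.Periodic (e4 ∘ ofComplex) (1 : ℝ) := periodic_of_modularForm _

lemma periodic_e6 : Function.Periodic (e6 ∘ ofComplex) (1 : ℝ) := periodic_of_modularForm _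

lemma hasSum_e2 (τ : ℍ) : HasSum (fun m : ℕ =>
    (if m = 0 then 1 else -24 * ArithmeticFunction.sigma 1 m : ℂ) •
      Function.Periodic.qParam 1 τ ^ m) (e2 τ) := by
  simpa only [Function.Periodic.qParam, Complex.ofReal_one, div_one, e2] using
    hasSum_qExpansion_E2 (z := τ)

lemma periodic_e2 : Function.Periodic (e2 ∘ ofComplex) (1 : ℝ) := by
  intro w
  by_cases! hw : 0 < w.im
  · have hw' : 0 < (w + (1 : ℝ)).im := by simpa using hw
    rw [Function.comp_apply, Function.comp_apply, ofComplex_apply_of_im_pos hw,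
      ofComplex_apply_of_im_pos hw']
    refine (hasSum_e2 _).unique ?_
    have := hasSum_e2 ⟨w, hw⟩
    have hp : Function.Periodic.qParam 1 (w + (1 : ℝ)) = Function.Periodic.qParam 1 w := by
      simp [Function.Periodic.qParam, mul_add, Complex.exp_add]
    simp only at this ⊢
    rwa [hp]
  · have hw' : (w + (1 : ℝ)).im ≤ 0 := by simpa using hw
    rw [Function.comp_apply, Function.comp_apply, ofComplex_apply_of_im_nonpos hw,
      ofComplex_apply_of_im_nonpos hw']

lemma tendsto_e4 : Tendsto e4 atImInfty (𝓝 1) := tendsto_eisenstein _ ⟨2, rfl⟩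

lemma tendsto_e6 : Tendsto e6 atImInfty (𝓝 1) := tendsto_eisenstein _ ⟨3, rfl⟩

lemma tendsto_e2 : Tendsto e2 atImInfty (𝓝 1) := by
  have h := tendsto_cuspFunction_zero periodic_e2 mdifferentiable_e2 isBoundedAtImInfty_E2
  have h0 := (hasFPowerSeriesOnBall_cuspFunction one_pos
    (analyticAt_cuspFunction_zero one_pos periodic_e2 mdifferentiable_e2 isBoundedAtImInfty_E2)
    hasSum_e2).coeff_zero 0
  simp at h0
  rwa [← h0] at h

/-- The derivative tends to 0 and `E₂ f` to 1, so only `-(k / 12)` survives. This limit is the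
constant in each of Ramanujan's identities. -/
lemma tendsto_serreDerivative {f : ℍ → ℂ} (hper : Function.Periodic (f ∘ ofComplex) (1 : ℝ))
    (hf : MDiff f) (h1 : Tendsto f atImInfty (𝓝 1)) (k : ℂ) :
    Tendsto (serreDerivative k f) atImInfty (𝓝 (-(k / 12))) := by
  have h := (tendsto_deriv_atImInfty hper hf (h1.isBigO_one ℝ)).sub
    (((tendsto_e2.const_mul (k * 12⁻¹))).mul h1)
  convert! h using 2
  ring

/-- The Serre derivative of `E₄` is a form of weight 6 with limit `-1/3` at infinity, hence `-E₆ /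
3`. -/
lemma ramanujan_e4 (τ : ℍ) :
    3 * normalizedDerivOfComplex e4 τ = e2 τ * e4 τ - e6 τ := by
  have ht := tendsto_serreDerivative periodic_e4 mdifferentiable_e4 tendsto_e4 4
  have h := eq_smul_of_tendsto ModularForm.levelOne_weight_six_rank_one
    (f := modularFormOfTendsto (k := 6) (serreDerivative (4 : ℤ) e4)
      (serreDerivative_mdifferentiable _ mdifferentiable_e4)
      (fun γ => serreDerivative_slash_invariant mdifferentiable_e4
        (slash_modularForm ModularForm.E₄ γ)) (by exact_mod_cast ht))
    (g := ModularForm.E₆) tendsto_e6 ht τ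
  replace h : normalizedDerivOfComplex e4 τ - (4 : ℤ) * 12⁻¹ * e2 τ * e4 τ = -(4 / 12) * e6 τ := h
  push_cast at h
  linear_combination 3 * h

lemma ramanujan_e6 (τ : ℍ) :
    2 * normalizedDerivOfComplex e6 τ = e2 τ * e6 τ - e4 τ ^ 2 := by
  have ht := tendsto_serreDerivative periodic_e6 mdifferentiable_e6 tendsto_e6 6
  have hrank : Module.rank ℂ (ModularForm 𝒮ℒ 8) = 1 := by
    have := ModularForm.dimension_level_one 8 ⟨4, rfl⟩
    simpa [Nat.ModEq] using this
  have h := eq_smul_of_tendsto hrank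
    (f := modularFormOfTendsto (k := 8) (serreDerivative (6 : ℤ) e6)
      (serreDerivative_mdifferentiable _ mdifferentiable_e6)
      (fun γ => serreDerivative_slash_invariant mdifferentiable_e6
        (slash_modularForm ModularForm.E₆ γ)) (by exact_mod_cast ht))
    (g := ModularForm.mcast (by norm_num) (ModularForm.E₄.mul ModularForm.E₄))
    (by simpa using! tendsto_e4.mul tendsto_e4) ht τ
  replace h : normalizedDerivOfComplex e6 τ - (6 : ℤ) * 12⁻¹ * e2 τ * e6 τ =
    -(6 / 12) * (e4 τ * e4 τ) := h
  push_cast at h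
  linear_combination 2 * h

section E2

variable (γ : SL(2, ℤ))

lemma hasDerivAt_D2 (τ : ℍ) : HasDerivAt (D2 γ ∘ ofComplex)
    (-(2 * Real.pi * Complex.I * (γ 1 0 / denom γ τ) ^ 2)) (τ : ℂ) := by
  have h := (hasDerivAt_denom_zpow γ (-1) τ).const_mul (2 * Real.pi * Complex.I * γ 1 0 : ℂ)
  have h' := h.congr_of_eventuallyEq (f₁ := D2 γ ∘ ofComplex) (by
    filter_upwards [isOpen_upperHalfPlaneSet.mem_nhds τ.im_pos] with w hw
    simp [D2, ofComplex_apply_of_im_pos hw, div_eq_mul_inv])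
  convert! h' using 1
  have := denom_ne_zero γ τ
  simp [zpow_ofNat]
  field_simp

lemma mdifferentiable_D2 : MDiff (D2 γ) :=
  mdifferentiable_iff.2 fun z hz => by
    have := (hasDerivAt_D2 γ ⟨z, hz⟩).differentiableAt
    exact this.differentiableWithinAt

lemma e2_slash : e2 ∣[(2 : ℤ)] γ = e2 - (3 / Real.pi ^ 2 : ℂ) • D2 γ := by
  have h := E2_slash_action γ
  rw [riemannZeta_two] at h
  rw [e2, h]
  congr 2
  field_simp
  norm_num

/-- `E₂` is not modular, and the Serre derivative is taken with parameter 1 instead of the weight 2.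
With `u = γ₁₀ / (γ₁₀ τ + γ₁₁)`, the terms in `u` and `u²` produced by `D E₂` then cancel those of
`E₂² / 12`. -/
lemma serreDerivative_e2_slash :
    serreDerivative 1 e2 ∣[(4 : ℤ)] γ = serreDerivative 1 e2 := by
  have hpi : (Real.pi : ℂ) ≠ 0 := by exact_mod_cast Real.pi_ne_zero
  ext τ
  have h1 := congrFun (normalizedDerivOfComplex_SL_slash (k := 2) mdifferentiable_e2 (γ := γ)) τ
  rw [e2_slash, normalizedDerivOfComplex_sub _ _ mdifferentiable_e2
    ((mdifferentiable_D2 γ).const_smul _), normalizedDerivOfComplex_smul _ _ (mdifferentiable_D2 γ)]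
    at h1
  have h2 : normalizedDerivOfComplex (D2 γ) τ = -(γ 1 0 / denom γ τ) ^ 2 := by
    rw [normalizedDerivOfComplex, (hasDerivAt_D2 γ τ).deriv]
    field_simp
  have h3 := congrFun (e2_slash γ) τ
  have h4 : serreDerivative 1 e2 = normalizedDerivOfComplex e2 - (12⁻¹ : ℂ) • (e2 * e2) := by
    ext z
    simp [e2]
    ring
  have h5 : (serreDerivative 1 e2 ∣[(4 : ℤ)] γ) τ =
      (normalizedDerivOfComplex e2 ∣[(2 + 2 : ℤ)] γ) τ - 12⁻¹ * ((e2 ∣[(2 : ℤ)] γ) τ) ^ 2 := by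
    rw [h4, sub_eq_add_neg, SlashAction.add_slash, SlashAction.neg_slash,
      ModularForm.SL_smul_slash, show (4 : ℤ) = 2 + 2 from rfl, ModularForm.mul_slash_SL2]
    simp [sq, sub_eq_add_neg]
  have hD : D2 γ τ = 2 * Real.pi * Complex.I * (γ 1 0 / denom γ τ) := by
    simp [D2]; ring
  simp only [Pi.sub_apply, Pi.smul_apply, smul_eq_mul] at h1 h3
  rw [h5, h3, h4]
  simp only [Pi.sub_apply, Pi.smul_apply, Pi.mul_apply, smul_eq_mul]
  rw [h2] at h1
  rw [hD] at h1 ⊢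
  generalize (γ 1 0 : ℂ) / denom γ τ = u at *
  rw [mul_inv, mul_inv, Complex.inv_I] at h1
  push_cast at h1
  have hI := Complex.I_sq
  field_simp at h1 ⊢
  grind

end E2

lemma ramanujan_e2 (τ : ℍ) :
    12 * normalizedDerivOfComplex e2 τ = e2 τ ^ 2 - e4 τ := by
  have ht := tendsto_serreDerivative periodic_e2 mdifferentiable_e2 tendsto_e2 1
  have h := eq_smul_of_tendsto ModularForm.levelOne_weight_four_rank_one
    (f := modularFormOfTendsto (k := 4) (serreDerivative 1 e2)
      (serreDerivative_mdifferentiable _ mdifferentiable_e2) serreDerivative_e2_slash ht)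
    (g := ModularForm.E₄) tendsto_e4 ht τ
  replace h : normalizedDerivOfComplex e2 τ - 1 * 12⁻¹ * e2 τ * e2 τ = -(1 / 12) * e4 τ := h
  linear_combination 12 * h

end

section

/-! ### Uniqueness of periodic solutions of the Ramanujan system -/

open Filter Topology

/-- A `1`-periodic solution of `v' = c v²` on a half plane vanishes. -/
lemma eq_zero_of_periodic_of_hasDerivAt {Y : ℝ} {v : ℂ → ℂ} {c : ℂ} (hc : c ≠ 0)
    (hv : ∀ z : ℂ, Y < z.im → HasDerivAt v (c * v z ^ 2) z)
    (hper : ∀ z : ℂ, Y < z.im → v (z + 1) = v z) {z : ℂ} (hz : Y < z.im) : v z = 0 := by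
  set h : ℝ → ℂ := fun x => v (z + x) with hh
  have hd : ∀ x, HasDerivAt h (c * h x ^ 2) x := fun x =>
    ((hv (z + x) (by simpa using hz)).comp_const_add z x).comp_ofReal
  have hcont : Continuous h := continuous_iff_continuousAt.2 fun x => (hd x).continuousAt
  -- An integrating factor: `h E` is constant, so `E' = -c h E` is constant too and `E 1 = 1 - c
  -- h(0)`. With `h 1 = h 0` this yields `c h(0)² = 0`, without ever dividing by `h`.
  set E : ℝ → ℂ := fun x => Complex.exp (-∫ y in (0 : ℝ)..x, c * h y) with hE
  have hE' : ∀ x, HasDerivAt E (E x * -(c * h x)) x := fun x =>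
    ((continuous_const.mul hcont).integral_hasStrictDerivAt 0 x).hasDerivAt.neg.cexp
  have hE0 : E 0 = 1 := by simp [hE]
  have h1 : ∀ x, h x * E x = h 0 := fun x => by
    have hp : ∀ x, HasDerivAt (fun x => h x * E x) 0 x := fun x => by
      convert! (hd x).mul (hE' x) using 1
      ring
    have := is_const_of_deriv_eq_zero (fun x => (hp x).differentiableAt)
      (fun x => (hp x).deriv) x 0
    rw [this, hE0, mul_one]
  have h2 : E 1 + c * h 0 = 1 := by
    have hp : ∀ x : ℝ, HasDerivAt (fun x : ℝ => E x + c * h 0 * x) 0 x := fun x => by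
      convert! (hE' x).add ((hasDerivAt_id (x : ℂ)).comp_ofReal.const_mul (c * h 0)) using 1
      linear_combination c * h1 x
    have := is_const_of_deriv_eq_zero (fun x => (hp x).differentiableAt)
      (fun x => (hp x).deriv) 1 0
    simpa [hE0] using this
  have h3 : h 1 = h 0 := by simpa [hh] using hper z hz
  have h4 := h1 1
  rw [h3] at h4
  have h5 : c * h 0 ^ 2 = 0 := by linear_combination h 0 * h2 - h4
  have h6 : h 0 = 0 := by simpa [hc] using h5
  simpa [hh] using h6

/-- Two periodic solutions of the Ramanujan system, up to a change of time scale `μ`, with the same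
value of `R² / Q³`, agree. -/
lemma ramanujan_unique {Y : ℝ} {P Q R a b e μ : ℂ → ℂ} {c : ℂ} (hc : c ≠ 0)
    (hμ : ∀ z, Y < z.im → R z * b z = μ z * (Q z * e z))
    (hQ0 : ∀ z, Y < z.im → Q z ≠ 0) (hR0 : ∀ z, Y < z.im → R z ≠ 0)
    (hb0 : ∀ z, Y < z.im → b z ≠ 0) (he0 : ∀ z, Y < z.im → e z ≠ 0)
    (hrel : ∀ z, Y < z.im → R z ^ 2 * b z ^ 3 = e z ^ 2 * Q z ^ 3)
    (hP : ∀ z, Y < z.im → HasDerivAt P (c * ((P z ^ 2 - Q z) / 12)) z)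
    (hQ : ∀ z, Y < z.im → HasDerivAt Q (c * ((P z * Q z - R z) / 3)) z)
    (hR : ∀ z, Y < z.im → HasDerivAt R (c * ((P z * R z - Q z ^ 2) / 2)) z)
    (ha : ∀ z, Y < z.im → HasDerivAt a (c * μ z * ((a z ^ 2 - b z) / 12)) z)
    (hb : ∀ z, Y < z.im → HasDerivAt b (c * μ z * ((a z * b z - e z) / 3)) z)
    (he : ∀ z, Y < z.im → HasDerivAt e (c * μ z * ((a z * e z - b z ^ 2) / 2)) z)
    (hper : ∀ z, Y < z.im → P (z + 1) = P z ∧ a (z + 1) = a z ∧ μ (z + 1) = μ z)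
    (hlim : Tendsto (fun t : ℝ => μ (t * Complex.I)) atTop (𝓝 1)) {z : ℂ} (hz : Y < z.im) :
    P z = a z ∧ Q z = b z ∧ R z = e z := by
  have hμ0 : ∀ z, Y < z.im → μ z ≠ 0 := fun z hz h0 => by
    have := hμ z hz
    simp [h0, hR0 z hz, hb0 z hz] at this
  have hQb : ∀ z, Y < z.im → Q z = μ z ^ 2 * b z := fun z hz => by
    have h1 : Q z * (Q z ^ 2 * e z ^ 2) = μ z ^ 2 * b z * (Q z ^ 2 * e z ^ 2) := by
      linear_combination -(hrel z hz) + (b z * (R z * b z + μ z * (Q z * e z))) * hμ z hz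
    exact mul_right_cancel₀
      (mul_ne_zero (pow_ne_zero _ (hQ0 z hz)) (pow_ne_zero _ (he0 z hz))) h1
  have hRe : ∀ z, Y < z.im → R z = μ z ^ 3 * e z := fun z hz => by
    refine mul_right_cancel₀ (hb0 z hz) ?_
    rw [hμ z hz, hQb z hz]
    ring
  -- Logarithmic derivative of `μ = R b / (Q e)`. Since `Q = μ² b` and `R = μ³ e`, the terms `Q²/R`
  -- and `R/Q` cancel against `μ b²/e` and `μ e/b`.
  have hmd : ∀ z, Y < z.im → HasDerivAt μ (c * (μ z * (P z - μ z * a z) / 6)) z := fun z hz => by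
    have h1 : HasDerivAt (fun z => R z * b z / (Q z * e z)) _ z :=
      ((hR z hz).mul (hb z hz)).div ((hQ z hz).mul (he z hz)) (mul_ne_zero (hQ0 z hz) (he0 z hz))
    have h2 : μ =ᶠ[𝓝 z] fun z => R z * b z / (Q z * e z) := by
      filter_upwards [(isOpen_lt continuous_const Complex.continuous_im).mem_nhds hz] with w hw
      rw [hμ w hw, mul_div_cancel_right₀ _ (mul_ne_zero (hQ0 w hw) (he0 w hw))]
    refine (h1.congr_of_eventuallyEq h2).congr_deriv ?_
    simp only [Pi.mul_apply]
    rw [hQb z hz, hRe z hz]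
    have := hμ0 z hz
    have := he0 z hz
    have := hb0 z hz
    field_simp
    ring
  -- The contributions of `Q` and `μ² b` cancel, and what remains is a perfect square.
  have hvd : ∀ z, Y < z.im → HasDerivAt (fun z => P z - μ z * a z)
      (c / 12 * (P z - μ z * a z) ^ 2) z := fun z hz => by
    refine ((hP z hz).sub ((hmd z hz).mul (ha z hz))).congr_deriv ?_
    rw [hQb z hz]
    ring
  have hv0 : ∀ z, Y < z.im → P z - μ z * a z = 0 := fun z hz =>
    eq_zero_of_periodic_of_hasDerivAt (div_ne_zero hc (by norm_num)) hvd
      (fun z hz => by rw [(hper z hz).1, (hper z hz).2.1, (hper z hz).2.2]) hz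
  have hμ1 : μ z = 1 := by
    have hd0 : ∀ z, Y < z.im → HasDerivAt μ 0 z := fun z hz => by
      simpa [hv0 z hz] using hmd z hz
    have hconst : ∀ w : ℂ, Y < w.im → μ w = μ z := fun w hw =>
      (isOpen_lt continuous_const Complex.continuous_im).is_const_of_deriv_eq_zero
        (convex_halfSpace_im_gt Y).isPreconnected
        (fun x hx => (hd0 x hx).differentiableAt.differentiableWithinAt)
        (fun x hx => (hd0 x hx).deriv) hw hz
    refine tendsto_nhds_unique (tendsto_const_nhds.congr' ?_) hlim
    filter_upwards [eventually_gt_atTop Y] with t ht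
    exact (hconst _ (by simpa using ht)).symm
  have h1 := hv0 z hz
  have h2 := hQb z hz
  have h3 := hRe z hz
  rw [hμ1] at h1 h2 h3
  exact ⟨by linear_combination h1, by linear_combination h2, by linear_combination h3⟩

end

section

/-! ### Substituting `t = 1 / j` -/

open Filter Topology Derivative
open scoped Manifold

lemma one_div_jInv (τ : ℍ) :
    1 / jInv τ = (e4 τ ^ 3 - e6 τ ^ 2) / (1728 * e4 τ ^ 3) := by
  rw [jInv, one_div_div, ModularForm.discriminant_eq_E₄_cube_sub_E₆_sq, div_div]
  rfl

lemma tendsto_one_div_jInv : Tendsto (fun τ => 1 / jInv τ) atImInfty (𝓝 0) := by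
  simp_rw [one_div_jInv]
  have h : Tendsto (fun τ => (e4 τ ^ 3 - e6 τ ^ 2) / (1728 * e4 τ ^ 3)) atImInfty
      (𝓝 ((1 ^ 3 - 1 ^ 2) / (1728 * 1 ^ 3))) :=
    ((tendsto_e4.pow 3).sub (tendsto_e6.pow 2)).div ((tendsto_e4.pow 3).const_mul 1728)
      (by norm_num)
  simpa using h

lemma one_div_jInv_ne_zero {τ : ℍ} (h : e4 τ ≠ 0) : 1 / jInv τ ≠ 0 := by
  rw [jInv, one_div_div]
  exact div_ne_zero (ModularForm.discriminant_ne_zero τ) (pow_ne_zero _ h)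

lemma tendsto_one_div_jInv_punctured :
    Tendsto (fun τ => 1 / jInv τ) atImInfty (𝓝[≠] 0) := by
  refine tendsto_nhdsWithin_iff.2 ⟨tendsto_one_div_jInv, ?_⟩
  filter_upwards [tendsto_e4.eventually_ne one_ne_zero] with τ hτ
  exact one_div_jInv_ne_zero hτ

lemma tendsto_ev {g : ℂ⟦X⟧} (hg : ConvOn (1 / 1728) g) (h0 : coeff 0 g = 1) :
    Tendsto (fun τ => ev g (1 / jInv τ)) atImInfty (𝓝 1) := by
  have h := hg.continuousAt (x := 0) (by norm_num)
  rw [ContinuousAt, ev_zero, h0] at h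
  exact h.comp tendsto_one_div_jInv

/-- The substitution `t = 1 / j` is well behaved at `τ`. -/
structure Good (τ : ℍ) : Prop where
  e4_ne : e4 τ ≠ 0
  e6_ne : e6 τ ≠ 0
  norm_lt : ‖1 / jInv τ‖ < 1 / 1728
  F1_ne : ev F1 (1 / jInv τ) ≠ 0
  sqrt_ne : ev sqrtSeries (1 / jInv τ) ≠ 0

lemma exists_good : ∃ Y : ℝ, 0 ≤ Y ∧ ∀ τ : ℍ, Y < τ.im → Good τ := by
  have h : ∀ᶠ τ in atImInfty, Good τ := by
    filter_upwards [tendsto_e4.eventually_ne one_ne_zero, tendsto_e6.eventually_ne one_ne_zero,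
      (tendsto_ev convOn_F1 coeff_zero_F1).eventually_ne one_ne_zero,
      (tendsto_ev convOn_sqrtSeries coeff_zero_sqrtSeries).eventually_ne one_ne_zero,
      tendsto_one_div_jInv.norm.eventually_lt_const (u := 1 / 1728) (by norm_num)]
      with τ h1 h2 h3 h4 h5 using ⟨h1, h2, h5, h3, h4⟩
  obtain ⟨A, hA⟩ := (atImInfty_mem _).1 h
  -- The bound is made nonnegative so that every complex `z` with `Y < z.im` is a point of `ℍ`.
  exact ⟨max A 0, le_max_right _ _, fun τ hτ => hA τ ((le_max_left _ _).trans hτ.le)⟩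

lemma hasDerivAt_comp_ofComplex {f : ℍ → ℂ} (hf : MDiff f) (τ : ℍ) :
    HasDerivAt (f ∘ ofComplex) (2 * Real.pi * Complex.I * normalizedDerivOfComplex f τ) τ := by
  have h := (mdifferentiableAt_iff.mp (hf τ)).hasDerivAt
  refine h.congr_deriv ?_
  rw [normalizedDerivOfComplex]
  field_simp

/-- By Ramanujan's identities; the terms in `E₂` cancel because `E₆² / E₄³` has weight 0. -/
lemma hasDerivAt_one_div_jInv {τ : ℍ} (h4 : e4 τ ≠ 0) :
    HasDerivAt ((fun τ => 1 / jInv τ) ∘ ofComplex)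
      (2 * Real.pi * Complex.I * (1 / jInv τ * (e6 τ / e4 τ))) τ := by
  have hQ := hasDerivAt_comp_ofComplex mdifferentiable_e4 τ
  have hR := hasDerivAt_comp_ofComplex mdifferentiable_e6 τ
  have h : HasDerivAt (fun z => ((e4 ∘ ofComplex) z ^ 3 - (e6 ∘ ofComplex) z ^ 2) /
      (1728 * (e4 ∘ ofComplex) z ^ 3)) _ (τ : ℂ) :=
    ((hQ.pow 3).sub (hR.pow 2)).div ((hQ.pow 3).const_mul 1728) (by simpa using h4)
  have he : (fun τ => 1 / jInv τ) ∘ ofComplex = fun z =>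
      ((e4 ∘ ofComplex) z ^ 3 - (e6 ∘ ofComplex) z ^ 2) / (1728 * (e4 ∘ ofComplex) z ^ 3) := by
    funext z
    exact one_div_jInv _
  rw [he]
  refine h.congr_deriv ?_
  rw [one_div_jInv]
  simp only [Function.comp_apply, ofComplex_apply, Pi.sub_apply, Pi.pow_apply]
  have r4 := ramanujan_e4 τ
  have r6 := ramanujan_e6 τ
  rw [show normalizedDerivOfComplex e4 τ = (e2 τ * e4 τ - e6 τ) / 3 by linear_combination r4 / 3,
    show normalizedDerivOfComplex e6 τ = (e2 τ * e6 τ - e4 τ ^ 2) / 2 by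
      linear_combination r6 / 2]
  field_simp
  ring

lemma convOn_gen2 : ConvOn (1 / 1728) (F1 * F2) := convOn_F1.mul convOn_F2

lemma convOn_gen4 : ConvOn (1 / 1728) (F1 ^ 4) := convOn_F1.pow 4

lemma convOn_gen6 : ConvOn (1 / 1728) (sqrtSeries * F1 ^ 6) :=
  convOn_sqrtSeries.mul (convOn_F1.pow 6)

lemma convOn_derivF {g : ℂ⟦X⟧} (hg : ConvOn (1 / 1728) g) : ConvOn (1 / 1728) (derivF g) := by
  rw [derivF_apply]
  exact (convOn_sqrtSeries.mul (convOn_F1.pow 2)).mul hg.euler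

/-- The ratio between `E₆ / E₄` and its hypergeometric counterpart. -/
def timeScale (τ : ℍ) : ℂ :=
  e6 τ / e4 τ / (ev sqrtSeries (1 / jInv τ) * ev F1 (1 / jInv τ) ^ 2)

/-- By the chain rule `D` acts as `(E₆ / E₄) θ`, whereas `derivF` is `s F1 ^ 2 θ`; `timeScale` is
the quotient of the two factors. -/
lemma hasDerivAt_ev_comp {g : ℂ⟦X⟧} (hg : ConvOn (1 / 1728) g) {τ : ℍ} (hτ : Good τ) :
    HasDerivAt ((fun τ => ev g (1 / jInv τ)) ∘ ofComplex)
      (2 * Real.pi * Complex.I * timeScale τ * ev (derivF g) (1 / jInv τ)) τ := by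
  obtain ⟨d, hd, hd'⟩ := hg.hasDerivAt hτ.norm_lt
  have hd2 : HasDerivAt (ev g) d (((fun τ => 1 / jInv τ) ∘ ofComplex) (τ : ℂ)) := by
    simpa using hd
  have h := hd2.comp (τ : ℂ) (hasDerivAt_one_div_jInv hτ.e4_ne)
  refine h.congr_deriv ?_
  rw [derivF_apply, ev_mul (convOn_sqrtSeries.mul (convOn_F1.pow 2)) hg.euler hτ.norm_lt,
    ev_mul convOn_sqrtSeries (convOn_F1.pow 2) hτ.norm_lt, ev_pow convOn_F1 hτ.norm_lt, hd',
    timeScale]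
  have := hτ.e4_ne
  have := hτ.F1_ne
  have := hτ.sqrt_ne
  field_simp

lemma ev_ofNat_mul (n : ℕ) {g : ℂ⟦X⟧} {x : ℂ} (hg : ConvOn (1 / 1728) g) (hx : ‖x‖ < 1 / 1728) :
    ev (n * g) x = n * ev g x := by
  rw [show (n : ℂ⟦X⟧) = C (n : ℂ) by simp, ev_mul (ConvOn.C _) hg hx, ev_C]

lemma ev_neg {g : ℂ⟦X⟧} {x : ℂ} : ev (-g) x = - ev g x := by
  simp [ev, tsum_neg]

lemma ConvOn.neg {r : ℝ} {g : ℂ⟦X⟧} (hg : ConvOn r g) : ConvOn r (-g) := fun x hx => by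
  simpa using hg x hx

lemma ev_sub {r : ℝ} {g h : ℂ⟦X⟧} {x : ℂ} (hg : ConvOn r g) (hh : ConvOn r h) (hx : ‖x‖ < r) :
    ev (g - h) x = ev g x - ev h x := by
  rw [sub_eq_add_neg, ev_add hg hh.neg hx, ev_neg, sub_eq_add_neg]

lemma ev_derivF_gen2 {x : ℂ} (hx : ‖x‖ < 1 / 1728) : ev (derivF (F1 * F2)) x =
    (ev (F1 * F2) x ^ 2 - ev (F1 ^ 4) x) / 12 := by
  have h := congrArg (ev · x) derivF_gen2
  have h1 := ev_ofNat_mul 12 (convOn_derivF convOn_gen2) hx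
  push_cast at h1
  rw [h1, ev_sub (convOn_gen2.pow 2) convOn_gen4 hx, ev_pow convOn_gen2 hx] at h
  linear_combination h / 12

lemma ev_derivF_gen4 {x : ℂ} (hx : ‖x‖ < 1 / 1728) : ev (derivF (F1 ^ 4)) x =
    (ev (F1 * F2) x * ev (F1 ^ 4) x - ev (sqrtSeries * F1 ^ 6) x) / 3 := by
  have h := congrArg (ev · x) derivF_gen4
  have h1 := ev_ofNat_mul 3 (convOn_derivF convOn_gen4) hx
  push_cast at h1
  rw [h1, ev_sub (convOn_gen2.mul convOn_gen4) convOn_gen6 hx,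
    ev_mul convOn_gen2 convOn_gen4 hx] at h
  linear_combination h / 3

lemma ev_derivF_gen6 {x : ℂ} (hx : ‖x‖ < 1 / 1728) : ev (derivF (sqrtSeries * F1 ^ 6)) x =
    (ev (F1 * F2) x * ev (sqrtSeries * F1 ^ 6) x - ev (F1 ^ 4) x ^ 2) / 2 := by
  have h := congrArg (ev · x) derivF_gen6
  have h1 := ev_ofNat_mul 2 (convOn_derivF convOn_gen6) hx
  push_cast at h1
  rw [h1, ev_sub (convOn_gen2.mul convOn_gen6) (convOn_gen4.pow 2) hx,
    ev_mul convOn_gen2 convOn_gen6 hx, ev_pow convOn_gen4 hx] at h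
  linear_combination h / 2

lemma ev_sqrtSeries_sq {x : ℂ} (hx : ‖x‖ < 1 / 1728) : ev sqrtSeries x ^ 2 = 1 - 1728 * x := by
  have hX : ConvOn (1 / 1728) X := fun y _ =>
    summable_of_ne_finset_zero (s := {1}) fun n hn => by
      simp [coeff_X, show n ≠ 1 by simpa using hn]
  have hX' : ev X x = x := by
    rw [ev, tsum_eq_single 1 fun n hn => by simp [coeff_X, hn]]
    simp
  have h := congrArg (ev · x) sqrtSeries_sq
  simp only [show (1728 : ℂ⟦X⟧) = C 1728 from rfl] at h
  rwa [ev_pow convOn_sqrtSeries hx, ev_sub (by simpa using ConvOn.C 1) ((ConvOn.C _).mul hX) hx,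
    ev_mul (ConvOn.C _) hX hx, ev_C, hX', show ev 1 x = 1 by simpa using ev_C 1 x] at h

/-- The Eisenstein series as power series in `1 / j`. -/
theorem eisenstein_eq_ev {Y : ℝ} (hY : 0 ≤ Y) (hgood : ∀ τ : ℍ, Y < τ.im → Good τ) {τ : ℍ}
    (hτ : Y < τ.im) : e2 τ = ev (F1 * F2) (1 / jInv τ) ∧ e4 τ = ev (F1 ^ 4) (1 / jInv τ) ∧
      e6 τ = ev (sqrtSeries * F1 ^ 6) (1 / jInv τ) := by
  have lift : ∀ z : ℂ, Y < z.im → ∃ σ : ℍ, (σ : ℂ) = z ∧ Good σ := fun z hz =>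
    ⟨⟨z, hY.trans_lt hz⟩, rfl, hgood _ hz⟩
  have hper : ∀ z : ℂ, jInv (ofComplex (z + 1)) = jInv (ofComplex z) := fun z => by
    have h4 := periodic_e4 z
    have h6 := periodic_e6 z
    simp only [Function.comp_apply, Complex.ofReal_one] at h4 h6
    simp only [jInv, ModularForm.discriminant_eq_E₄_cube_sub_E₆_sq]
    change e4 _ ^ 3 / ((e4 _ ^ 3 - e6 _ ^ 2) / 1728) = e4 _ ^ 3 / ((e4 _ ^ 3 - e6 _ ^ 2) / 1728)
    rw [h4, h6]
  have ev4 : ∀ {σ : ℍ}, Good σ → ev (F1 ^ 4) (1 / jInv σ) = ev F1 (1 / jInv σ) ^ 4 :=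
    fun h => ev_pow convOn_F1 h.norm_lt 4
  have ev6 : ∀ {σ : ℍ}, Good σ → ev (sqrtSeries * F1 ^ 6) (1 / jInv σ) =
      ev sqrtSeries (1 / jInv σ) * ev F1 (1 / jInv σ) ^ 6 := fun h => by
    rw [ev_mul convOn_sqrtSeries (convOn_F1.pow 6) h.norm_lt, ev_pow convOn_F1 h.norm_lt]
  have key := ramanujan_unique (Y := Y) (c := 2 * Real.pi * Complex.I)
    (P := e2 ∘ ofComplex) (Q := e4 ∘ ofComplex) (R := e6 ∘ ofComplex)
    (a := (fun τ => ev (F1 * F2) (1 / jInv τ)) ∘ ofComplex)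
    (b := (fun τ => ev (F1 ^ 4) (1 / jInv τ)) ∘ ofComplex)
    (e := (fun τ => ev (sqrtSeries * F1 ^ 6) (1 / jInv τ)) ∘ ofComplex)
    (μ := timeScale ∘ ofComplex) (by simp) ?_ ?_ ?_ ?_ ?_ ?_ ?_ ?_ ?_ ?_ ?_ ?_ ?_ ?_
    (z := τ) hτ
  · simpa using key
  · intro z hz
    obtain ⟨σ, rfl, hσ⟩ := lift z hz
    simp only [Function.comp_apply, ofComplex_apply]
    rw [ev4 hσ, ev6 hσ, timeScale]
    have := hσ.e4_ne
    have := hσ.F1_ne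
    have := hσ.sqrt_ne
    field_simp
  · intro z hz
    obtain ⟨σ, rfl, hσ⟩ := lift z hz
    simpa using hσ.e4_ne
  · intro z hz
    obtain ⟨σ, rfl, hσ⟩ := lift z hz
    simpa using hσ.e6_ne
  · intro z hz
    obtain ⟨σ, rfl, hσ⟩ := lift z hz
    simp only [Function.comp_apply, ofComplex_apply]
    rw [ev4 hσ]
    exact pow_ne_zero _ hσ.F1_ne
  · intro z hz
    obtain ⟨σ, rfl, hσ⟩ := lift z hz
    simp only [Function.comp_apply, ofComplex_apply]
    rw [ev6 hσ]
    exact mul_ne_zero hσ.sqrt_ne (pow_ne_zero _ hσ.F1_ne)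
  · intro z hz
    obtain ⟨σ, rfl, hσ⟩ := lift z hz
    simp only [Function.comp_apply, ofComplex_apply]
    -- The powers of `F1` cancel in `e² / b³ = s² = 1 - 1728 / j`, which is `E₆² / E₄³`.
    have hs := ev_sqrtSeries_sq hσ.norm_lt
    rw [ev4 hσ, ev6 hσ, mul_pow, hs, one_div_jInv]
    have := hσ.e4_ne
    field_simp
    ring
  · intro z hz
    obtain ⟨σ, rfl, hσ⟩ := lift z hz
    refine (hasDerivAt_comp_ofComplex mdifferentiable_e2 σ).congr_deriv ?_
    simp only [Function.comp_apply, ofComplex_apply]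
    linear_combination 2 * Real.pi * Complex.I / 12 * ramanujan_e2 σ
  · intro z hz
    obtain ⟨σ, rfl, hσ⟩ := lift z hz
    refine (hasDerivAt_comp_ofComplex mdifferentiable_e4 σ).congr_deriv ?_
    simp only [Function.comp_apply, ofComplex_apply]
    linear_combination 2 * Real.pi * Complex.I / 3 * ramanujan_e4 σ
  · intro z hz
    obtain ⟨σ, rfl, hσ⟩ := lift z hz
    refine (hasDerivAt_comp_ofComplex mdifferentiable_e6 σ).congr_deriv ?_
    simp only [Function.comp_apply, ofComplex_apply]
    linear_combination 2 * Real.pi * Complex.I / 2 * ramanujan_e6 σ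
  · intro z hz
    obtain ⟨σ, rfl, hσ⟩ := lift z hz
    refine (hasDerivAt_ev_comp convOn_gen2 hσ).congr_deriv ?_
    simp only [Function.comp_apply, ofComplex_apply, ev_derivF_gen2 hσ.norm_lt]
  · intro z hz
    obtain ⟨σ, rfl, hσ⟩ := lift z hz
    refine (hasDerivAt_ev_comp convOn_gen4 hσ).congr_deriv ?_
    simp only [Function.comp_apply, ofComplex_apply, ev_derivF_gen4 hσ.norm_lt]
  · intro z hz
    obtain ⟨σ, rfl, hσ⟩ := lift z hz
    refine (hasDerivAt_ev_comp convOn_gen6 hσ).congr_deriv ?_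
    simp only [Function.comp_apply, ofComplex_apply, ev_derivF_gen6 hσ.norm_lt]
  · intro z _
    have h2 := periodic_e2 z
    have h4 := periodic_e4 z
    have h6 := periodic_e6 z
    simp only [Function.comp_apply, Complex.ofReal_one] at h2 h4 h6
    simp only [Function.comp_apply, timeScale, h2, h4, h6, hper, and_self]
  · have h : Tendsto timeScale atImInfty (𝓝 (1 / 1 / (1 * 1 ^ 2))) :=
      (tendsto_e6.div tendsto_e4 one_ne_zero).div
        ((tendsto_ev convOn_sqrtSeries coeff_zero_sqrtSeries).mul
          ((tendsto_ev convOn_F1 coeff_zero_F1).pow 2)) (by norm_num)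
    norm_num at h
    refine h.comp (tendsto_comap_im_ofComplex.comp (tendsto_comap_iff.2 ?_))
    refine tendsto_id.congr fun t => ?_
    simp

end

/-! ### Graded subalgebras on three generators -/

section Generators

variable {A : Type*} [CommRing A] [Algebra ℂ A] (a b c : A)

/-- The generator of weight `2`. -/
def gen2 : genAlg a b c := ⟨a, Algebra.subset_adjoin (by simp)⟩

/-- The generator of weight `4`. -/
def gen4 : genAlg a b c := ⟨b, Algebra.subset_adjoin (by simp)⟩

/-- The generator of weight `6`. -/
def gen6 : genAlg a b c := ⟨c, Algebra.subset_adjoin (by simp)⟩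

/-- The monomials of weight `w` in the generators. -/
def monomials (w : ℕ) : Set (genAlg a b c) :=
  {x | ∃ l m n : ℕ, 2 * l + 4 * m + 6 * n = w ∧ x = gen2 a b c ^ l * gen4 a b c ^ m * gen6 a b c ^ n}

lemma genPiece_eq_span (w : ℕ) : genPiece a b c w = Submodule.span ℂ (monomials a b c w) := by
  have h : {x : A | ∃ l m n : ℕ, 2 * l + 4 * m + 6 * n = w ∧ x = a ^ l * b ^ m * c ^ n} =
      (genAlg a b c).val.toLinearMap '' monomials a b c w := by
    ext x
    constructor
    · rintro ⟨l, m, n, hw, rfl⟩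
      exact ⟨_, ⟨l, m, n, hw, rfl⟩, rfl⟩
    · rintro ⟨_, ⟨l, m, n, hw, rfl⟩, rfl⟩
      exact ⟨l, m, n, hw, rfl⟩
  rw [genPiece, h, Submodule.span_image]
  exact Submodule.comap_map_eq_of_injective Subtype.val_injective _

lemma gradedMonoid_genPiece : SetLike.GradedMonoid (genPiece a b c) where
  one_mem := by
    rw [genPiece_eq_span]
    exact Submodule.subset_span ⟨0, 0, 0, rfl, by simp⟩
  mul_mem i j x y hx hy := by
    rw [genPiece_eq_span] at *
    have h := Submodule.mul_mem_mul hx hy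
    rw [Submodule.span_mul_span] at h
    refine Submodule.span_mono ?_ h
    rintro _ ⟨_, ⟨l, m, n, hw, rfl⟩, _, ⟨l', m', n', hw', rfl⟩, rfl⟩
    exact ⟨l + l', m + m', n + n', by lia, by simp only [pow_add]; ring⟩

lemma iSup_genPiece : ⨆ w, genPiece a b c w = ⊤ := by
  have hmon : ∀ x ∈ Submonoid.closure ({a, b, c} : Set A),
      ∃ l m n : ℕ, x = a ^ l * b ^ m * c ^ n := fun x hx => by
    induction hx using Submonoid.closure_induction with
    | mem x hx =>
      rcases hx with rfl | rfl | rfl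
      exacts [⟨1, 0, 0, by simp⟩, ⟨0, 1, 0, by simp⟩, ⟨0, 0, 1, by simp⟩]
    | one => exact ⟨0, 0, 0, by simp⟩
    | mul x y _ _ hx hy =>
      obtain ⟨l, m, n, rfl⟩ := hx
      obtain ⟨l', m', n', rfl⟩ := hy
      exact ⟨l + l', m + m', n + n', by ring⟩
  rw [eq_top_iff]
  rintro ⟨x, hx⟩ -
  suffices h : x ∈ (⨆ w, genPiece a b c w).map (genAlg a b c).val.toLinearMap by
    obtain ⟨y, hy, rfl⟩ := h
    exact hy
  rw [genAlg, ← Subalgebra.mem_toSubmodule, Algebra.adjoin_eq_span] at hx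
  refine Submodule.span_le.2 (fun y hy => ?_) hx
  obtain ⟨l, m, n, rfl⟩ := hmon y hy
  refine ⟨gen2 a b c ^ l * gen4 a b c ^ m * gen6 a b c ^ n, ?_, rfl⟩
  refine Submodule.mem_iSup_of_mem (2 * l + 4 * m + 6 * n) ?_
  rw [genPiece_eq_span]
  exact Submodule.subset_span ⟨l, m, n, rfl, rfl⟩

/-- Multiplicativity and exhaustion hold for any three generators; only independence of the pieces
has to be supplied. -/
lemma nonempty_gradedAlgebra (h : iSupIndep (genPiece a b c)) :
    Nonempty (GradedAlgebra (genPiece a b c)) := by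
  have := gradedMonoid_genPiece a b c
  exact ⟨{ (DirectSum.isInternal_submodule_of_iSupIndep_of_iSup_eq_top h
    (iSup_genPiece a b c)).chooseDecomposition with }⟩

variable {a b c}

/-- A derivation satisfying Ramanujan's identities raises the weight by `2`. -/
lemma derivation_genPiece (D : Derivation ℂ (genAlg a b c) (genAlg a b c))
    (h2 : 12 * D (gen2 a b c) = gen2 a b c ^ 2 - gen4 a b c)
    (h4 : 3 * D (gen4 a b c) = gen2 a b c * gen4 a b c - gen6 a b c)
    (h6 : 2 * D (gen6 a b c) = gen2 a b c * gen6 a b c - gen4 a b c ^ 2)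
    (w : ℕ) (f : genAlg a b c) (hf : f ∈ genPiece a b c w) : D f ∈ genPiece a b c (w + 2) := by
  have hm : ∀ l m n w : ℕ, 2 * l + 4 * m + 6 * n = w →
      gen2 a b c ^ l * gen4 a b c ^ m * gen6 a b c ^ n ∈ genPiece a b c w := fun l m n w h => by
    rw [genPiece_eq_span]
    exact Submodule.subset_span ⟨l, m, n, h, rfl⟩
  have := gradedMonoid_genPiece a b c
  have hdiv : ∀ (k w : ℕ) (x : genAlg a b c), k ≠ 0 → (k : genAlg a b c) * x ∈ genPiece a b c w →
      x ∈ genPiece a b c w := fun k w x hk hx => by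
    have hx' : x = (k : ℂ)⁻¹ • ((k : genAlg a b c) * x) := by
      rw [← nsmul_eq_mul, ← Nat.cast_smul_eq_nsmul ℂ, smul_smul, inv_mul_cancel₀ (by simpa), one_smul]
    rw [hx']
    exact Submodule.smul_mem _ _ hx
  have d2 : D (gen2 a b c) ∈ genPiece a b c (2 + 2) := hdiv 12 _ _ (by norm_num) (by
    push_cast
    rw [h2]
    exact sub_mem (by simpa using hm 2 0 0 4 rfl) (by simpa using hm 0 1 0 4 rfl))
  have d4 : D (gen4 a b c) ∈ genPiece a b c (4 + 2) := hdiv 3 _ _ (by norm_num) (by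
    push_cast
    rw [h4]
    exact sub_mem (by simpa using hm 1 1 0 6 rfl) (by simpa using hm 0 0 1 6 rfl))
  have d6 : D (gen6 a b c) ∈ genPiece a b c (6 + 2) := hdiv 2 _ _ (by norm_num) (by
    push_cast
    rw [h6]
    exact sub_mem (by simpa using hm 1 0 1 8 rfl) (by simpa using hm 0 2 0 8 rfl))
  have hprod : ∀ (i j k : ℕ) (x y : genAlg a b c), i + j = k → x ∈ genPiece a b c i →
      y ∈ genPiece a b c j → x * y ∈ genPiece a b c k := by
    rintro i j _ x y rfl hx hy
    exact SetLike.GradedMul.mul_mem hx hy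
  have hDmul : ∀ (i j k : ℕ) (x y : genAlg a b c), i + j = k → x ∈ genPiece a b c i →
      y ∈ genPiece a b c j → D x ∈ genPiece a b c (i + 2) → D y ∈ genPiece a b c (j + 2) →
      D (x * y) ∈ genPiece a b c (k + 2) := by
    rintro i j _ x y rfl hx hy hdx hdy
    rw [Derivation.leibniz]
    exact add_mem (hprod _ _ _ _ _ (by lia) hx hdy) (hprod _ _ _ _ _ (by lia) hy hdx)
  have hDpow : ∀ (i n : ℕ) (x : genAlg a b c), x ∈ genPiece a b c i →
      D x ∈ genPiece a b c (i + 2) → D (x ^ n) ∈ genPiece a b c (i * n + 2) := by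
    intro i n x hx hdx
    induction n with
    | zero => simp
    | succ n ih =>
      rw [pow_succ]
      refine hDmul (i * n) i _ _ _ (by ring) ?_ hx ih hdx
      simpa [mul_comm] using SetLike.pow_mem_graded n hx
  rw [genPiece_eq_span] at hf
  induction hf using Submodule.span_induction with
  | mem x hx =>
    obtain ⟨l, m, n, rfl, rfl⟩ := hx
    refine hDmul (2 * l + 4 * m) (6 * n) _ _ _ rfl (by simpa using hm l m 0 _ rfl)
      (by simpa using hm 0 0 n _ rfl) (hDmul (2 * l) (4 * m) _ _ _ rfl
        (by simpa using hm l 0 0 _ rfl) (by simpa using hm 0 m 0 _ rfl) ?_ ?_) ?_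
    · exact hDpow 2 l _ (by simpa using hm 1 0 0 _ rfl) d2
    · exact hDpow 4 m _ (by simpa using hm 0 1 0 _ rfl) d4
    · exact hDpow 6 n _ (by simpa using hm 0 0 1 _ rfl) d6
  | zero => simp
  | add x y _ _ hx hy => rw [map_add]; exact add_mem hx hy
  | smul r x _ hx => rw [Derivation.map_smul]; exact Submodule.smul_mem _ _ hx

variable {B : Type*} [CommRing B] [Algebra ℂ B] {a' b' c' : B}

lemma map_genPiece (φ : genAlg a b c ≃ₐ[ℂ] genAlg a' b' c') (h2 : φ (gen2 a b c) = gen2 a' b' c')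
    (h4 : φ (gen4 a b c) = gen4 a' b' c') (h6 : φ (gen6 a b c) = gen6 a' b' c') (w : ℕ)
    (f : genAlg a b c) : f ∈ genPiece a b c w ↔ φ f ∈ genPiece a' b' c' w := by
  have himage : φ.toLinearMap '' monomials a b c w = monomials a' b' c' w := by
    ext x
    constructor
    · rintro ⟨_, ⟨l, m, n, hw, rfl⟩, rfl⟩
      exact ⟨l, m, n, hw, by simp [h2, h4, h6]⟩
    · rintro ⟨l, m, n, hw, rfl⟩
      exact ⟨_, ⟨l, m, n, hw, rfl⟩, by simp [h2, h4, h6]⟩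
  rw [genPiece_eq_span, genPiece_eq_span, ← himage, Submodule.span_image]
  exact (Function.Injective.mem_set_image φ.injective).symm

lemma map_genAlg (φ : A →ₐ[ℂ] B) (a b c : A) :
    (genAlg a b c).map φ = genAlg (φ a) (φ b) (φ c) := by
  rw [genAlg, genAlg, AlgHom.map_adjoin]
  congr 1
  simp [Set.image_insert_eq]

end Generators

/-! ### The weight grading on quasimodular forms -/

section Grading

open Filter Topology
open scoped MatrixGroups ModularForm

/-- The translates `τ + n`. -/
def translate (τ : ℍ) (n : ℕ) : ℍ := (n : ℝ) +ᵥ τ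

lemma coe_translate (τ : ℍ) (n : ℕ) : (translate τ n : ℂ) = τ + n := by
  simp [translate, add_comm]

lemma apply_translate {f : ℍ → ℂ} (hf : Function.Periodic (f ∘ ofComplex) (1 : ℝ)) (τ : ℍ) (n : ℕ) :
    f (translate τ n) = f τ := by
  have h := hf.nat_mul n τ
  rw [Complex.ofReal_one, mul_one, ← coe_translate] at h
  simpa using h

lemma tendsto_inv_translate (τ : ℍ) :
    Tendsto (fun n => ((translate τ n : ℂ))⁻¹) atTop (𝓝 0) := by
  refine tendsto_inv₀_cobounded.comp ?_
  simp_rw [coe_translate]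
  rw [← tendsto_norm_atTop_iff_cobounded]
  refine tendsto_atTop_mono (f := fun n : ℕ => (n : ℝ) + -‖(τ : ℂ)‖) (fun n => ?_)
    (tendsto_atTop_add_const_right _ _ tendsto_natCast_atTop_atTop)
  have := norm_sub_le ((τ : ℂ) + n) τ
  rw [add_sub_cancel_left, Complex.norm_natCast] at this
  linarith

lemma apply_S_smul {k : ℕ} (f : ModularForm 𝒮ℒ k) (τ : ℍ) :
    f (ModularGroup.S • τ) = (τ : ℂ) ^ k * f τ := by
  have h := congrFun (slash_modularForm f ModularGroup.S) τ
  rw [ModularForm.SL_slash_apply, ModularGroup.denom_S, zpow_neg, zpow_natCast] at h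
  rw [← h]
  have := ne_zero τ
  field_simp

lemma e2_S_smul (τ : ℍ) :
    e2 (ModularGroup.S • τ) = (τ : ℂ) ^ 2 * e2 τ - 6 * Complex.I / Real.pi * τ := by
  have h := congrFun (e2_slash ModularGroup.S) τ
  rw [ModularForm.SL_slash_apply, ModularGroup.denom_S, Pi.sub_apply, Pi.smul_apply,
    EisensteinSeries.D2_S, zpow_neg] at h
  have h1 := ne_zero τ
  have h2 : (Real.pi : ℂ) ≠ 0 := by exact_mod_cast Real.pi_ne_zero
  have h3 : e2 (ModularGroup.S • τ) =
      e2 (ModularGroup.S • τ) * ((τ : ℂ) ^ (2 : ℤ))⁻¹ * (τ : ℂ) ^ 2 := by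
    rw [zpow_ofNat]; field_simp
  rw [h3, h, smul_eq_mul]
  field_simp
  ring

/-- The leading behaviour of a form of weight `w` under `τ ↦ -1 / (τ + n)`. -/
lemma tendsto_of_mem_QMw {w : ℕ} {f : QM} (hf : f ∈ QMw w) (τ : ℍ) :
    Tendsto (fun n => (f : ℍ → ℂ) (ModularGroup.S • translate τ n) * ((translate τ n : ℂ))⁻¹ ^ w)
      atTop (𝓝 ((f : ℍ → ℂ) τ)) := by
  rw [QMw, genPiece_eq_span] at hf
  induction hf using Submodule.span_induction with
  | mem x hx =>
    obtain ⟨l, m, n, rfl, rfl⟩ := hx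
    have h2 : Tendsto (fun n => e2 (ModularGroup.S • translate τ n) *
        ((translate τ n : ℂ))⁻¹ ^ 2) atTop (𝓝 (e2 τ)) := by
      -- After division by `(τ + n)²` the anomaly of `E₂` under `S` is of order `1 / (τ + n)` and
      -- disappears in the limit.
      have := ((tendsto_inv_translate τ).const_mul (6 * Complex.I / Real.pi)).const_sub (e2 τ)
      rw [mul_zero, sub_zero] at this
      refine this.congr fun n => ?_
      have h0 := ne_zero (translate τ n)
      rw [e2_S_smul, apply_translate periodic_e2]
      field_simp
    have h4 : ∀ k, e4 (ModularGroup.S • translate τ k) * ((translate τ k : ℂ))⁻¹ ^ 4 = e4 τ :=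
        fun k => by
      have h0 := ne_zero (translate τ k)
      rw [e4, apply_S_smul, ← e4, apply_translate periodic_e4]
      field_simp
      exact mul_comm _ _
    have h6 : ∀ k, e6 (ModularGroup.S • translate τ k) * ((translate τ k : ℂ))⁻¹ ^ 6 = e6 τ :=
        fun k => by
      have h0 := ne_zero (translate τ k)
      rw [e6, apply_S_smul, ← e6, apply_translate periodic_e6]
      field_simp
      exact mul_comm _ _
    refine (((h2.pow l).mul_const (e4 τ ^ m)).mul_const (e6 τ ^ n)).congr fun k => ?_
    rw [← h4 k, ← h6 k]
    change _ = (e2 ^ l * e4 ^ m * e6 ^ n) _ * _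
    simp only [Pi.mul_apply, Pi.pow_apply]
    ring
  | zero => simp
  | add x y _ _ hx hy => simpa [add_mul] using hx.add hy
  | smul r x _ hx => simpa [mul_assoc] using hx.const_mul r

/-- In a vanishing sum with largest weight `a`, evaluate at `-1 / (τ + n)` and divide by `(τ + n) ^
a`. As `n → ∞` the lower weights tend to 0 and the top component tends to its value at `τ`, which is
therefore 0. -/
lemma iSupIndep_QMw : iSupIndep QMw := by
  rw [iSupIndep_iff_finsetSum_eq_zero_imp_eq_zero]
  intro s
  induction s using Finset.induction_on_max with
  | empty => simp
  | insert a s hlt ih =>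
    intro v hv hsum
    have ha : a ∉ s := fun h => (hlt a h).false
    rw [Finset.sum_insert ha] at hsum
    have h0 : v a = 0 := by
      ext τ
      have hlim := tendsto_of_mem_QMw (hv a (Finset.mem_insert_self _ _)) τ
      have hz : Tendsto (fun n => ∑ i ∈ s, (-((v i : ℍ → ℂ) (ModularGroup.S • translate τ n) *
          ((translate τ n : ℂ))⁻¹ ^ i) * ((translate τ n : ℂ))⁻¹ ^ (a - i))) atTop
          (𝓝 (∑ i ∈ s, -(v i : ℍ → ℂ) τ * 0)) := by
        refine tendsto_finsetSum _ fun i hi => ?_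
        have h1 := tendsto_of_mem_QMw (hv i (Finset.mem_insert_of_mem hi)) τ
        have h2 := (tendsto_inv_translate τ).pow (a - i)
        rw [zero_pow (Nat.sub_ne_zero_of_lt (hlt i hi))] at h2
        exact h1.neg.mul h2
      have hva : v a = -∑ i ∈ s, v i := eq_neg_of_add_eq_zero_left hsum
      have heq := tendsto_nhds_unique hlim (hz.congr fun n => ?_)
      · simpa using heq
      · rw [hva]
        simp only [NegMemClass.coe_neg, AddSubmonoidClass.coe_finsetSum, Pi.neg_apply,
          Finset.sum_apply, neg_mul, Finset.sum_mul, Finset.sum_neg_distrib]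
        congr 1
        refine Finset.sum_congr rfl fun i hi => ?_
        rw [mul_assoc, ← pow_add, Nat.add_sub_cancel' (hlt i hi).le]
    rw [h0, zero_add] at hsum
    intro i hi
    rcases Finset.mem_insert.1 hi with rfl | hi
    · exact h0
    · exact ih v (fun j hj => hv j (Finset.mem_insert_of_mem hj)) hsum i hi

end Grading

section

/-! ### The algebra of pairs of corresponding elements -/

open Filter Topology Derivative
open scoped Manifold

/-- The algebra generated by the pairs `(E₂, F₁ F₂)`, `(E₄, F₁ ^ 4)`, `(E₆, (1 - 1728 t)^(1/2) F₁ ^ 6)`: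
the graph of the isomorphism between `QM` and `FF`. -/
abbrev pairs : Subalgebra ℂ ((ℍ → ℂ) × ℂ⟦X⟧) :=
  genAlg (e2, F1 * F2) (e4, F1 ^ 4) (e6, sqrtSeries * F1 ^ 6)

lemma fst_mem_QM {p : (ℍ → ℂ) × ℂ⟦X⟧} (hp : p ∈ pairs) : p.1 ∈ QM := by
  have h := map_genAlg (AlgHom.fst ℂ (ℍ → ℂ) ℂ⟦X⟧) (e2, F1 * F2) (e4, F1 ^ 4)
    (e6, sqrtSeries * F1 ^ 6)
  change AlgHom.fst ℂ (ℍ → ℂ) ℂ⟦X⟧ p ∈ genAlg e2 e4 e6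
  exact h ▸ Subalgebra.mem_map.2 ⟨p, hp, rfl⟩

lemma snd_mem_FF {p : (ℍ → ℂ) × ℂ⟦X⟧} (hp : p ∈ pairs) : p.2 ∈ FF := by
  have h := map_genAlg (AlgHom.snd ℂ (ℍ → ℂ) ℂ⟦X⟧) (e2, F1 * F2) (e4, F1 ^ 4)
    (e6, sqrtSeries * F1 ^ 6)
  change AlgHom.snd ℂ (ℍ → ℂ) ℂ⟦X⟧ p ∈ genAlg (F1 * F2) (F1 ^ 4) (sqrtSeries * F1 ^ 6)
  exact h ▸ Subalgebra.mem_map.2 ⟨p, hp, rfl⟩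

lemma exists_pair_of_mem_QM {f : ℍ → ℂ} (hf : f ∈ QM) : ∃ g, (f, g) ∈ pairs := by
  have h := map_genAlg (AlgHom.fst ℂ (ℍ → ℂ) ℂ⟦X⟧) (e2, F1 * F2) (e4, F1 ^ 4)
    (e6, sqrtSeries * F1 ^ 6)
  obtain ⟨p, hp, rfl⟩ := Subalgebra.mem_map.1 (h.symm ▸ hf : f ∈ pairs.map (AlgHom.fst ℂ _ _))
  exact ⟨p.2, hp⟩

lemma exists_pair_of_mem_FF {g : ℂ⟦X⟧} (hg : g ∈ FF) : ∃ f, (f, g) ∈ pairs := by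
  have h := map_genAlg (AlgHom.snd ℂ (ℍ → ℂ) ℂ⟦X⟧) (e2, F1 * F2) (e4, F1 ^ 4)
    (e6, sqrtSeries * F1 ^ 6)
  obtain ⟨p, hp, rfl⟩ := Subalgebra.mem_map.1 (h.symm ▸ hg : g ∈ pairs.map (AlgHom.snd ℂ _ _))
  exact ⟨p.1, hp⟩

lemma deriv_e2 : normalizedDerivOfComplex e2 = (12⁻¹ : ℂ) • (e2 ^ 2 - e4) := by
  ext τ
  simp only [Pi.smul_apply, Pi.sub_apply, Pi.pow_apply, smul_eq_mul]
  linear_combination ramanujan_e2 τ / 12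

lemma deriv_e4 : normalizedDerivOfComplex e4 = (3⁻¹ : ℂ) • (e2 * e4 - e6) := by
  ext τ
  simp only [Pi.smul_apply, Pi.sub_apply, Pi.mul_apply, smul_eq_mul]
  linear_combination ramanujan_e4 τ / 3

lemma deriv_e6 : normalizedDerivOfComplex e6 = (2⁻¹ : ℂ) • (e2 * e6 - e4 ^ 2) := by
  ext τ
  simp only [Pi.smul_apply, Pi.sub_apply, Pi.mul_apply, Pi.pow_apply, smul_eq_mul]
  linear_combination ramanujan_e6 τ / 2

lemma eq_inv_smul_of_natCast_mul {n : ℕ} (hn : n ≠ 0) {g h : ℂ⟦X⟧} (H : (n : ℂ⟦X⟧) * g = h) :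
    g = (n : ℂ)⁻¹ • h := by
  rw [← H, ← nsmul_eq_mul, ← Nat.cast_smul_eq_nsmul ℂ, smul_smul, inv_mul_cancel₀ (by simpa),
    one_smul]

/-- Corresponding derivatives of corresponding elements correspond. -/
lemma deriv_mem_pairs {p : (ℍ → ℂ) × ℂ⟦X⟧} (hp : p ∈ pairs) :
    MDiff p.1 ∧ (normalizedDerivOfComplex p.1, derivF p.2) ∈ pairs := by
  have m2 : (e2, F1 * F2) ∈ pairs := Algebra.subset_adjoin (by simp)
  have m4 : (e4, F1 ^ 4) ∈ pairs := Algebra.subset_adjoin (by simp)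
  have m6 : (e6, sqrtSeries * F1 ^ 6) ∈ pairs := Algebra.subset_adjoin (by simp)
  induction hp using Algebra.adjoin_induction with
  | mem p hp =>
    rcases hp with rfl | rfl | rfl
    · refine ⟨mdifferentiable_e2, ?_⟩
      rw [deriv_e2, eq_inv_smul_of_natCast_mul (n := 12) (by simp) derivF_gen2]
      exact pairs.smul_mem (sub_mem (pow_mem m2 2) m4) _
    · refine ⟨mdifferentiable_e4, ?_⟩
      rw [deriv_e4, eq_inv_smul_of_natCast_mul (n := 3) (by simp) derivF_gen4]
      exact pairs.smul_mem (sub_mem (mul_mem m2 m4) m6) _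
    · refine ⟨mdifferentiable_e6, ?_⟩
      rw [deriv_e6, eq_inv_smul_of_natCast_mul (n := 2) (by simp) derivF_gen6]
      exact pairs.smul_mem (sub_mem (mul_mem m2 m6) (pow_mem m4 2)) _
  | algebraMap r =>
    refine ⟨mdifferentiable_const, ?_⟩
    rw [show (algebraMap ℂ ((ℍ → ℂ) × ℂ⟦X⟧) r).1 = fun _ => r from rfl,
      normalizedDerivOfComplex_const, Prod.algebraMap_apply, Derivation.map_algebraMap]
    exact zero_mem _
  | add p q _ _ hp hq =>
    refine ⟨hp.1.add hq.1, ?_⟩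
    rw [Prod.fst_add, Prod.snd_add, normalizedDerivOfComplex_add _ _ hp.1 hq.1, map_add]
    exact add_mem hp.2 hq.2
  | mul p q hpm hqm hp hq =>
    refine ⟨hp.1.mul hq.1, ?_⟩
    rw [Prod.fst_mul, Prod.snd_mul, normalizedDerivOfComplex_mul _ _ hp.1 hq.1, Derivation.leibniz,
      add_comm, smul_eq_mul, smul_eq_mul, mul_comm _ q.1]
    exact add_mem (mul_mem hpm hq.2) (mul_mem hqm hp.2)

lemma ev_of_mem_pairs {Y : ℝ} (hY : 0 ≤ Y) (hgood : ∀ τ : ℍ, Y < τ.im → Good τ)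
    {p : (ℍ → ℂ) × ℂ⟦X⟧} (hp : p ∈ pairs) :
    ConvOn (1 / 1728) p.2 ∧ ∀ τ : ℍ, Y < τ.im → ev p.2 (1 / jInv τ) = p.1 τ := by
  induction hp using Algebra.adjoin_induction with
  | mem p hp =>
    rcases hp with rfl | rfl | rfl
    · exact ⟨convOn_gen2, fun τ hτ => (eisenstein_eq_ev hY hgood hτ).1.symm⟩
    · exact ⟨convOn_gen4, fun τ hτ => (eisenstein_eq_ev hY hgood hτ).2.1.symm⟩
    · exact ⟨convOn_gen6, fun τ hτ => (eisenstein_eq_ev hY hgood hτ).2.2.symm⟩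
  | algebraMap r => exact ⟨ConvOn.C r, fun τ _ => ev_C r _⟩
  | add p q _ _ hp hq =>
    refine ⟨hp.1.add hq.1, fun τ hτ => ?_⟩
    rw [Prod.snd_add, ev_add hp.1 hq.1 (hgood τ hτ).norm_lt, hp.2 τ hτ, hq.2 τ hτ]
    rfl
  | mul p q _ _ hp hq =>
    refine ⟨hp.1.mul hq.1, fun τ hτ => ?_⟩
    rw [Prod.snd_mul, ev_mul hp.1 hq.1 (hgood τ hτ).norm_lt, hp.2 τ hτ, hq.2 τ hτ]
    rfl

/-- The series vanishes at all points `1 / j(τ)` with large `Im τ`, and these accumulate at 0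
through nonzero values. -/
lemma snd_eq_zero_of_mem_pairs {g : ℂ⟦X⟧} (h : ((0 : ℍ → ℂ), g) ∈ pairs) : g = 0 := by
  obtain ⟨Y, hY, hgood⟩ := exists_good
  obtain ⟨hg, hev⟩ := ev_of_mem_pairs hY hgood h
  refine hg.eq_zero (by norm_num) tendsto_one_div_jInv_punctured ?_
  exact (atImInfty_mem _).2 ⟨Y + 1, fun τ hτ => hev τ (by linarith)⟩

/-- Such an `f` is holomorphic and vanishes on the half plane `Im τ > Y`, hence on all of `ℍ`. -/
lemma fst_eq_zero_of_mem_pairs {f : ℍ → ℂ} (h : (f, (0 : ℂ⟦X⟧)) ∈ pairs) : f = 0 := by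
  obtain ⟨Y, hY, hgood⟩ := exists_good
  obtain ⟨-, hev⟩ := ev_of_mem_pairs hY hgood h
  obtain ⟨τ, hτ⟩ : ∃ τ : ℍ, Y < τ.im :=
    ⟨⟨(Y + 1) * Complex.I, by simp; linarith⟩, by simp [UpperHalfPlane.im]⟩
  refine eq_zero_of_frequently (deriv_mem_pairs h).1 (τ := τ) (Eventually.frequently ?_)
  refine nhdsWithin_le_nhds ?_
  filter_upwards [(isOpen_lt continuous_const UpperHalfPlane.continuous_im).mem_nhds hτ] with σ hσ
  exact (hev σ hσ).symm.trans (by simp [ev])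

/-- The projection of `pairs` to quasimodular forms. -/
def pairsFst : pairs →ₐ[ℂ] QM :=
  ((AlgHom.fst ℂ (ℍ → ℂ) ℂ⟦X⟧).comp pairs.val).codRestrict QM fun p => fst_mem_QM p.2

/-- The projection of `pairs` to power series. -/
def pairsSnd : pairs →ₐ[ℂ] FF :=
  ((AlgHom.snd ℂ (ℍ → ℂ) ℂ⟦X⟧).comp pairs.val).codRestrict FF fun p => snd_mem_FF p.2

lemma bijective_pairsFst : Function.Bijective pairsFst := by
  refine ⟨(injective_iff_map_eq_zero _).2 ?_, fun f => ?_⟩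
  · rintro ⟨⟨f, g⟩, hp⟩ h
    obtain rfl : f = 0 := congrArg Subtype.val h
    obtain rfl := snd_eq_zero_of_mem_pairs hp
    rfl
  · obtain ⟨g, hg⟩ := exists_pair_of_mem_QM f.2
    exact ⟨⟨_, hg⟩, rfl⟩

lemma bijective_pairsSnd : Function.Bijective pairsSnd := by
  refine ⟨(injective_iff_map_eq_zero _).2 ?_, fun g => ?_⟩
  · rintro ⟨⟨f, g⟩, hp⟩ h
    obtain rfl : g = 0 := congrArg Subtype.val h
    obtain rfl := fst_eq_zero_of_mem_pairs hp
    rfl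
  · obtain ⟨f, hf⟩ := exists_pair_of_mem_FF g.2
    exact ⟨⟨_, hf⟩, rfl⟩

/-- The isomorphism from quasimodular forms to hypergeometric power series. -/
def isoQMFF : QM ≃ₐ[ℂ] FF :=
  (AlgEquiv.ofBijective pairsFst bijective_pairsFst).symm.trans
    (AlgEquiv.ofBijective pairsSnd bijective_pairsSnd)

lemma isoQMFF_eq_of_mem {f : QM} {g : FF} (h : ((f : ℍ → ℂ), (g : ℂ⟦X⟧)) ∈ pairs) :
    isoQMFF f = g := by
  have hf : f = AlgEquiv.ofBijective pairsFst bijective_pairsFst ⟨_, h⟩ := rfl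
  rw [isoQMFF, AlgEquiv.trans_apply, hf, AlgEquiv.symm_apply_apply]
  rfl

lemma pair_isoQMFF_mem (f : QM) : ((f : ℍ → ℂ), (isoQMFF f : ℂ⟦X⟧)) ∈ pairs := by
  obtain ⟨g, hg⟩ := exists_pair_of_mem_QM f.2
  rwa [isoQMFF_eq_of_mem (f := f) (g := ⟨g, snd_mem_FF hg⟩) hg]

lemma mdifferentiable_QM (f : QM) : MDiff (f : ℍ → ℂ) := (deriv_mem_pairs (pair_isoQMFF_mem f)).1

/-- The derivation `(2πi)⁻¹ d/dτ` of the ring of quasimodular forms. -/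
def derivQM : Derivation ℂ QM QM :=
  Derivation.mk'
    { toFun f := ⟨normalizedDerivOfComplex f, fst_mem_QM (deriv_mem_pairs (pair_isoQMFF_mem f)).2⟩
      map_add' f g := Subtype.ext
        (normalizedDerivOfComplex_add _ _ (mdifferentiable_QM f) (mdifferentiable_QM g))
      map_smul' r f := Subtype.ext (normalizedDerivOfComplex_smul r _ (mdifferentiable_QM f)) }
    fun f g => Subtype.ext <| by
      have h := normalizedDerivOfComplex_mul _ _ (mdifferentiable_QM f) (mdifferentiable_QM g)
      exact h.trans ((add_comm _ _).trans (congrArg _ (mul_comm _ _)))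

/-- The restriction of `derivF` to `FF`. -/
def derivFF : Derivation ℂ FF FF :=
  Derivation.mk'
    { toFun g := ⟨derivF g, by
        obtain ⟨f, hf⟩ := exists_pair_of_mem_FF g.2
        exact snd_mem_FF (deriv_mem_pairs hf).2⟩
      map_add' f g := Subtype.ext (map_add derivF _ _)
      map_smul' r f := Subtype.ext (derivF.map_smul r _) }
    fun f g => Subtype.ext (derivF.leibniz _ _)

lemma isoQMFF_deriv (f : QM) : isoQMFF (derivQM f) = derivFF (isoQMFF f) :=
  isoQMFF_eq_of_mem (deriv_mem_pairs (pair_isoQMFF_mem f)).2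

lemma isoQMFF_gen2 : isoQMFF (gen2 e2 e4 e6) =
    gen2 (F1 * F2) (F1 ^ 4) (sqrtSeries * F1 ^ 6) :=
  isoQMFF_eq_of_mem (Algebra.subset_adjoin (by simp [gen2]))

lemma isoQMFF_gen4 : isoQMFF (gen4 e2 e4 e6) =
    gen4 (F1 * F2) (F1 ^ 4) (sqrtSeries * F1 ^ 6) :=
  isoQMFF_eq_of_mem (Algebra.subset_adjoin (by simp [gen4]))

lemma isoQMFF_gen6 : isoQMFF (gen6 e2 e4 e6) =
    gen6 (F1 * F2) (F1 ^ 4) (sqrtSeries * F1 ^ 6) :=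
  isoQMFF_eq_of_mem (Algebra.subset_adjoin (by simp [gen6]))

lemma mem_QMw_iff (w : ℕ) (f : QM) : f ∈ QMw w ↔ isoQMFF f ∈ FFw w :=
  map_genPiece isoQMFF isoQMFF_gen2 isoQMFF_gen4 isoQMFF_gen6 w f

/-- Transported along the isomorphism: the argument for quasimodular forms uses the action of `S`,
which is not visible on power series in `t`. -/
lemma iSupIndep_FFw : iSupIndep FFw := by
  have h := iSupIndep_QMw
  rw [iSupIndep_iff_finsetSum_eq_zero_imp_eq_zero] at h ⊢
  intro s v hv hsum i hi
  have := h s (fun i => isoQMFF.symm (v i)) (fun i hi => by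
    rw [mem_QMw_iff, AlgEquiv.apply_symm_apply]
    exact hv i hi) (by rw [← map_sum, hsum, map_zero]) i hi
  simpa using this

lemma derivFF_mem (w : ℕ) (g : FF) (hg : g ∈ FFw w) : derivFF g ∈ FFw (w + 2) :=
  derivation_genPiece derivFF (Subtype.ext derivF_gen2) (Subtype.ext derivF_gen4)
    (Subtype.ext derivF_gen6) w g hg

lemma derivQM_mem (w : ℕ) (f : QM) (hf : f ∈ QMw w) : derivQM f ∈ QMw (w + 2) := by
  rw [mem_QMw_iff, isoQMFF_deriv]
  exact derivFF_mem w _ ((mem_QMw_iff w f).1 hf)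

lemma hasSum_isoQMFF : ∃ Y : ℝ, ∀ (f : QM) (τ : ℍ), Y < τ.im →
    HasSum (fun n : ℕ => coeff n (isoQMFF f : ℂ⟦X⟧) * (1 / jInv τ) ^ n) ((f : ℍ → ℂ) τ) := by
  obtain ⟨Y, hY, hgood⟩ := exists_good
  refine ⟨Y, fun f τ hτ => ?_⟩
  obtain ⟨hg, hev⟩ := ev_of_mem_pairs hY hgood (pair_isoQMFF_mem f)
  have := hg.hasSum (hgood τ hτ).norm_lt
  rwa [hev τ hτ] at this

end

end QuasiModular

end

theorem mainTheorem4 :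
    ∃ (D : Derivation ℂ QuasiModular.QM QuasiModular.QM)
      (DF : Derivation ℂ QuasiModular.FF QuasiModular.FF)
      (Φ : QuasiModular.QM ≃ₐ[ℂ] QuasiModular.FF),
      -- `D` is the restriction of `(2πi)⁻¹ d/dτ`, `DF` that of `(1 - 1728 t)^(1/2) F₁² t d/dt`
      (∀ f : QuasiModular.QM,
        (D f : UpperHalfPlane → ℂ) = Derivative.normalizedDerivOfComplex (f : UpperHalfPlane → ℂ)) ∧
      (∀ g : QuasiModular.FF,
        (DF g : PowerSeries ℂ) = QuasiModular.derivF (g : PowerSeries ℂ)) ∧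
      -- substituting `t = 1 / j(τ)` in `Φ f` gives `f(τ)` for all `τ` of large imaginary part
      (∃ Y : ℝ, ∀ (f : QuasiModular.QM) (τ : UpperHalfPlane), Y < τ.im →
        HasSum (fun n : ℕ => PowerSeries.coeff n (Φ f : PowerSeries ℂ) *
          (1 / QuasiModular.jInv τ) ^ n) ((f : UpperHalfPlane → ℂ) τ)) ∧
      -- the images of the generators `E₂`, `E₄`, `E₆`
      (∀ f : QuasiModular.QM,
        ((f : UpperHalfPlane → ℂ) = QuasiModular.e2 →
          (Φ f : PowerSeries ℂ) = QuasiModular.F1 * QuasiModular.F2) ∧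
        ((f : UpperHalfPlane → ℂ) = QuasiModular.e4 →
          (Φ f : PowerSeries ℂ) = QuasiModular.F1 ^ 4) ∧
        ((f : UpperHalfPlane → ℂ) = QuasiModular.e6 →
          (Φ f : PowerSeries ℂ) = QuasiModular.sqrtSeries * QuasiModular.F1 ^ 6)) ∧
      -- both rings are graded by weight, and both derivations are homogeneous of degree 2
      Nonempty (GradedAlgebra QuasiModular.QMw) ∧
      Nonempty (GradedAlgebra QuasiModular.FFw) ∧
      (∀ (w : ℕ), ∀ f ∈ QuasiModular.QMw w, D f ∈ QuasiModular.QMw (w + 2)) ∧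
      (∀ (w : ℕ), ∀ g ∈ QuasiModular.FFw w, DF g ∈ QuasiModular.FFw (w + 2)) ∧
      -- `Φ` is an isomorphism of graded differential algebras
      (∀ (w : ℕ) (f : QuasiModular.QM),
        f ∈ QuasiModular.QMw w ↔ Φ f ∈ QuasiModular.FFw w) ∧
      (∀ f : QuasiModular.QM, Φ (D f) = DF (Φ f)) := by

  refine ⟨QuasiModular.derivQM, QuasiModular.derivFF, QuasiModular.isoQMFF, fun _ => rfl,
    fun _ => rfl, QuasiModular.hasSum_isoQMFF, fun f => ⟨fun h => ?_, fun h => ?_, fun h => ?_⟩,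
    QuasiModular.nonempty_gradedAlgebra _ _ _ QuasiModular.iSupIndep_QMw,
    QuasiModular.nonempty_gradedAlgebra _ _ _ QuasiModular.iSupIndep_FFw,
    QuasiModular.derivQM_mem, QuasiModular.derivFF_mem, QuasiModular.mem_QMw_iff,
    QuasiModular.isoQMFF_deriv⟩
  · obtain rfl : f = QuasiModular.gen2 _ _ _ := Subtype.ext h
    exact congrArg Subtype.val QuasiModular.isoQMFF_gen2
  · obtain rfl : f = QuasiModular.gen4 _ _ _ := Subtype.ext h
    exact congrArg Subtype.val QuasiModular.isoQMFF_gen4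
  · obtain rfl : f = QuasiModular.gen6 _ _ _ := Subtype.ext h
    exact congrArg Subtype.val QuasiModular.isoQMFF_gen6
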